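/- Let $S$ be a separable $C^*$-algebra, and let $\Gamma:=\widehat S$ be its spectrum, i.e. the set of unitary equivalence classes $[\pi]$ of irreducible $*$-representations of $S$, with the Jacobson (hull-kernel) topology. Assume that $S$ has continuous trace, i.e. that the linear span of the set of all $a\in S$, $a\ge 0$, for which the function $[\pi]\mapsto\operatorname{Tr}\pi(a)$ is finite and continuous on $\Gamma$, is dense in $S$. Let $\mathcal H=((H_\gamma)_{\gamma\in\Gamma},\mathcal F)$ be a continuous field of Hilbert spaces over $\Gamma$; that is, $\mathcal F\subseteq\prod_{\gamma}H_\gamma$ is a complex linear subspace such that $\{x(\gamma): x\in\mathcal F\}$ is dense in $H_\gamma$ for every $\gamma$, the function $\gamma\mapsto\|x(\gamma)\|$ is continuous for every $x\in\mathcal F$, and $\mathcal F$ contains every $x\in\prod_\gamma H_\gamma$ that is locally uniformly approximable by $\mathcal F$ (for every $\gamma_0\in\Gamma$ and $\varepsilon>0$ there is $y\in\mathcal F$ with $\|x(\gamma)-y(\gamma)\|\le\varepsilon$ for all $\gamma$ in some neighbourhood of $\gamma_0$). Let $\mathcal K(H_\gamma)$ denote the compact operators on $H_\gamma$. The continuous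 sections of the corresponding continuous field of elementary $C^*$-algebras $(\mathcal K(H_\gamma))_{\gamma\in\Gamma}$ are the families $T=(T_\gamma)_\gamma\in\prod_\gamma\mathcal K(H_\gamma)$ that are locally uniformly approximable, in the same sense and with respect to the operator norm, by finite linear combinations of the sections $\theta_{x,y}\colon\gamma\mapsto\langle\,\cdot\,,y(\gamma)\rangle\,x(\gamma)$ with $x,y\in\mathcal F$ (the inner product being linear in the first variable here). Let $\mathcal A_0(\mathcal H)$ be the $C^*$-algebra, with pointwise operations, of all such continuous sections $T$ for which $\gamma\mapsto\|T_\gamma\|$ vanishes at infinity on $\Gamma$. For every $\gamma\in\Gamma$ let $\pi_\gamma\colon S\to\mathcal B(H_\gamma)$ be an irreducible $*$-representation with $[\pi_\gamma]=\gamma$. Let $K_S^+$ be the positive part of the Pedersen ideal of $S$: the set of all $a\ge0$ in $S$ for which there are $n\in\mathbb N$ and $a_1,\dots,a_n$ with $a\le a_1+\cdots+a_n$, where each $a_i$ is of the form $\varphi(b)$ with $0\le b\in S$ and $\varphi\colon(0,\infty)\to[0,\infty)$ continuous with compact support. If $(\pi_\gamma(a))_{\gamma\in\Gamma}\in\mathcal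 A_0(\mathcal H)$ for every $a\in K_S^+$, then $(\pi_\gamma(a))_{\gamma\in\Gamma}\in\mathcal A_0(\mathcal H)$ for every $a\in S$, and the mapping $S\to\mathcal A_0(\mathcal H)$, $a\mapsto(\pi_\gamma(a))_{\gamma\in\Gamma}$, is a $*$-isomorphism. -/

import Mathlib

open Filter Topology InnerProductSpace
open scoped NNReal ENNReal

universe u v w

/-! ### Irreducible representations and the spectrum of a C*-algebra -/

/-- A `*`-representation is (topologically) irreducible if it is nonzero and its only closed
invariant subspaces are `0` and the whole Hilbert space. -/
def IsIrreducibleRep {A : Type u} [NonUnitalCStarAlgebra A] {H : Type v} [NormedAddCommGroup H]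
    [InnerProductSpace ℂ H] [CompleteSpace H] (π : A →⋆ₙₐ[ℂ] (H →L[ℂ] H)) : Prop :=
  π ≠ 0 ∧ ∀ K : Submodule ℂ H, IsClosed (K : Set H) → (∀ a : A, ∀ ξ ∈ K, π a ξ ∈ K) →
    K = ⊥ ∨ K = ⊤

/-- An irreducible `*`-representation of `A` on some Hilbert space (in `Type v`). -/
structure IrreducibleRep (A : Type u) [NonUnitalCStarAlgebra A] where
  /-- The representation space. -/
  space : Type v
  [normed : NormedAddCommGroup space]
  [inner : InnerProductSpace ℂ space]
  [complete : CompleteSpace space]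
  /-- The representation. -/
  rep : A →⋆ₙₐ[ℂ] (space →L[ℂ] space)
  irreducible : IsIrreducibleRep rep

attribute [instance] IrreducibleRep.normed IrreducibleRep.inner IrreducibleRep.complete

/-- Unitary equivalence of irreducible representations. -/
instance IrreducibleRep.setoid (A : Type u) [NonUnitalCStarAlgebra A] :
    Setoid (IrreducibleRep.{u, v} A) where
  r ρ σ := ∃ U : ρ.space ≃ₗᵢ[ℂ] σ.space, ∀ (a : A) (ξ : ρ.space),
    U (ρ.rep a ξ) = σ.rep a (U ξ)
  iseqv :=
    { refl := fun ρ => ⟨LinearIsometryEquiv.refl ℂ ρ.space, fun _ _ => rfl⟩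
      symm := by
        rintro ρ σ ⟨U, hU⟩
        refine ⟨U.symm, fun a ξ => ?_⟩
        apply U.injective
        rw [hU]
        simp
      trans := by
        rintro ρ σ τ ⟨U, hU⟩ ⟨V, hV⟩
        refine ⟨U.trans V, fun a ξ => ?_⟩
        simp [hU, hV] }

/-- The spectrum of a C*-algebra: the set of unitary equivalence classes of its irreducible
`*`-representations. -/
def CStarSpectrum (A : Type u) [NonUnitalCStarAlgebra A] : Type (max u (v + 1)) :=
  Quotient (IrreducibleRep.setoid.{u, v} A)

namespace CStarSpectrum

variable {A : Type u} [NonUnitalCStarAlgebra A]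

/-- The unitary equivalence class `[π]` of an irreducible representation `π`. -/
def mk {H : Type v} [NormedAddCommGroup H] [InnerProductSpace ℂ H] [CompleteSpace H]
    (π : A →⋆ₙₐ[ℂ] (H →L[ℂ] H)) (hπ : IsIrreducibleRep π) : CStarSpectrum.{u, v} A :=
  Quotient.mk _ ⟨H, π, hπ⟩

/-- The kernel of (any representative of) a class in the spectrum, a primitive ideal. -/
noncomputable def ker : CStarSpectrum.{u, v} A → TwoSidedIdeal A :=
  Quotient.lift (fun ρ => TwoSidedIdeal.ker ρ.rep) (by
    rintro ρ σ ⟨U, hU⟩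
    ext a
    rw [TwoSidedIdeal.mem_ker, TwoSidedIdeal.mem_ker]
    constructor
    · intro h
      ext ξ
      obtain ⟨η, rfl⟩ := U.surjective ξ
      rw [← hU, h]
      simp
    · intro h
      ext ξ
      apply U.injective
      rw [hU, h]
      simp)

/-- The Jacobson (hull-kernel) topology, pulled back from the primitive ideal space: the open sets
are the sets `{γ | ¬ I ⊆ ker γ}` with `I` a closed two-sided ideal of `A` (these sets are already
stable under unions and finite intersections). -/
instance : TopologicalSpace (CStarSpectrum.{u, v} A) :=
  TopologicalSpace.generateFrom
    {U | ∃ I : TwoSidedIdeal A, IsClosed (I : Set A) ∧ U = {γ | ¬ I ≤ γ.ker}}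

end CStarSpectrum

/-! ### Continuous trace -/

section Trace

variable {H : Type v} [NormedAddCommGroup H] [InnerProductSpace ℂ H] [CompleteSpace H]

/-- The trace `∑ᵢ ⟪eᵢ, T eᵢ⟫ ∈ [0, ∞]` of a positive bounded operator, with respect to an
orthonormal basis `(eᵢ)` (for positive `T` the sum is the same for every orthonormal basis). -/
noncomputable def positiveTrace (T : H →L[ℂ] H) : ℝ≥0∞ :=
  ∑' i : (exists_hilbertBasis ℂ H).choose,
    ENNReal.ofReal (RCLike.re (inner ℂ (i : H) (T (i : H))))

end Trace

section CStar

variable (A : Type u) [NonUnitalCStarAlgebra A] [PartialOrder A] [StarOrderedRing A]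

/-- The positive elements `a` for which `[π] ↦ Tr π(a)` is finite and continuous on the
spectrum. -/
def continuousTracePositive : Set A :=
  {a | 0 ≤ a ∧ ∃ f : CStarSpectrum.{u, v} A → ℝ≥0, Continuous f ∧
    ∀ ρ : IrreducibleRep.{u, v} A,
      positiveTrace (ρ.rep a) = (f (CStarSpectrum.mk ρ.rep ρ.irreducible) : ℝ≥0∞)}

/-- `A` has continuous trace: the linear span of the positive elements with finite continuous
trace function is dense in `A`. -/
def HasContinuousTrace : Prop :=
  Dense (Submodule.span ℂ (continuousTracePositive.{u, v} A) : Set A)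

/-! ### The Pedersen ideal -/

/-- The elements `φ(b)` with `b ≥ 0` and `φ : (0, ∞) → [0, ∞)` continuous with compact support
(`φ` is extended by zero to the real line). -/
def pedersenGenerators : Set A :=
  {a | 0 ≤ a ∧ ∃ b : A, 0 ≤ b ∧ ∃ φ : ℝ → ℝ, Continuous φ ∧ (∀ x, 0 ≤ φ x) ∧
    HasCompactSupport φ ∧ tsupport φ ⊆ Set.Ioi 0 ∧ a = cfcₙ φ b}

/-- The positive part of the Pedersen ideal of `A`. -/
def pedersenPositive : Set A :=
  {a | 0 ≤ a ∧ ∃ (n : ℕ) (c : Fin n → A), (∀ i, c i ∈ pedersenGenerators A) ∧ a ≤ ∑ i, c i}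

end CStar

/-! ### Continuous fields of Hilbert spaces and their elementary C*-algebras -/

/-- `x` is, near every point, a uniform limit of members of `Λ`. -/
def LocallyApproximable {T : Type w} [TopologicalSpace T] {V : T → Type v}
    [∀ t, NormedAddCommGroup (V t)] (Λ : Set (∀ t, V t)) (x : ∀ t, V t) : Prop :=
  ∀ t : T, ∀ ε : ℝ, 0 < ε → ∃ y ∈ Λ, ∀ᶠ s in 𝓝 t, ‖x s - y s‖ ≤ ε

/-- A continuous field of Hilbert spaces over `T` with fibres `H t`, given by its space of
continuous sections. -/
structure ContinuousHilbertField {T : Type w} [TopologicalSpace T] (H : T → Type v)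
    [∀ t, NormedAddCommGroup (H t)] [∀ t, InnerProductSpace ℂ (H t)] where
  /-- The continuous sections, a complex linear subspace of the product of the fibres. -/
  sections : Submodule ℂ (∀ t, H t)
  dense_fiber : ∀ t, Dense {ξ : H t | ∃ x ∈ sections, x t = ξ}
  continuous_norm : ∀ x ∈ sections, Continuous fun t => ‖x t‖
  mem_of_locallyApproximable : ∀ x, LocallyApproximable (sections : Set (∀ t, H t)) x →
    x ∈ sections

namespace ContinuousHilbertField

variable {T : Type w} [TopologicalSpace T] {H : T → Type v}
  [∀ t, NormedAddCommGroup (H t)] [∀ t, InnerProductSpace ℂ (H t)]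
  (E : ContinuousHilbertField H)

theorem continuous_inner {x y : ∀ t, H t} (hx : x ∈ E.sections) (hy : y ∈ E.sections) :
    Continuous fun t => inner ℂ (x t) (y t) := by
  have h1 := E.continuous_norm _ (E.sections.add_mem hx hy)
  have h2 := E.continuous_norm _ (E.sections.sub_mem hx hy)
  have h3 := E.continuous_norm _
    (E.sections.sub_mem hx (E.sections.smul_mem (Complex.I) hy))
  have h4 := E.continuous_norm _
    (E.sections.add_mem hx (E.sections.smul_mem (Complex.I) hy))
  simp only [Pi.add_apply, Pi.sub_apply, Pi.smul_apply] at h1 h2 h3 h4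
  have key : ∀ t, inner ℂ (x t) (y t) =
      (((‖x t + y t‖ : ℂ) ^ 2 - (‖x t - y t‖ : ℂ) ^ 2 +
        ((‖x t - Complex.I • y t‖ : ℂ) ^ 2 - (‖x t + Complex.I • y t‖ : ℂ) ^ 2) * Complex.I) / 4) :=
    fun t => inner_eq_sum_norm_sq_div_four (𝕜 := ℂ) (x t) (y t)
  simp_rw [key]
  fun_prop

theorem smul_mem {f : T → ℂ} (hf : Continuous f) {x : ∀ t, H t} (hx : x ∈ E.sections) :
    (fun t => f t • x t) ∈ E.sections := by
  apply E.mem_of_locallyApproximable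
  intro t ε hε
  refine ⟨f t • x, E.sections.smul_mem _ hx, ?_⟩
  have hc : Continuous fun s => ‖f s - f t‖ * ‖x s‖ :=
    ((hf.sub continuous_const).norm).mul (E.continuous_norm x hx)
  have ht : ‖f t - f t‖ * ‖x t‖ < ε := by simpa using hε
  filter_upwards [(hc.tendsto t).eventually (Iio_mem_nhds ht)] with s hs
  rw [Pi.smul_apply, ← sub_smul, norm_smul]
  exact (show ‖f s - f t‖ * ‖x s‖ < ε from hs).le

/-- The finite sums of sections `t ↦ θ_{x(t), y(t)}`, where `x`, `y` are continuous sections of the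
field of Hilbert spaces and `θ_{ξ, η}` is the operator `ζ ↦ ⟪η, ζ⟫ ξ`. -/
def finiteRankSections : Submodule ℂ (∀ t, H t →L[ℂ] H t) :=
  Submodule.span ℂ {θ | ∃ x ∈ E.sections, ∃ y ∈ E.sections, θ = fun t => rankOne ℂ (x t) (y t)}

theorem finiteRankSections_mul_mem {a b : ∀ t, H t →L[ℂ] H t} (ha : a ∈ E.finiteRankSections)
    (hb : b ∈ E.finiteRankSections) : a * b ∈ E.finiteRankSections := by
  induction ha using Submodule.span_induction with
  | zero => simp
  | add p q _ _ hp hq => rw [add_mul]; exact Submodule.add_mem _ hp hq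
  | smul c p _ hp => rw [smul_mul_assoc]; exact Submodule.smul_mem _ _ hp
  | mem p hp =>
    obtain ⟨x, hx, y, hy, rfl⟩ := hp
    induction hb using Submodule.span_induction with
    | zero => simp
    | add p q _ _ hp hq => rw [mul_add]; exact Submodule.add_mem _ hp hq
    | smul c p _ hp => rw [mul_smul_comm]; exact Submodule.smul_mem _ _ hp
    | mem q hq =>
      obtain ⟨z, hz, w, hw, rfl⟩ := hq
      refine Submodule.subset_span
        ⟨fun t => inner ℂ (y t) (z t) • x t, E.smul_mem (E.continuous_inner hy hz) hx, w, hw, ?_⟩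
      funext t
      ext ξ
      simp [smul_smul, mul_comm]

theorem finiteRankSections_locally_bounded {a : ∀ t, H t →L[ℂ] H t}
    (ha : a ∈ E.finiteRankSections) (t : T) : ∃ C : ℝ, 0 ≤ C ∧ ∀ᶠ s in 𝓝 t, ‖a s‖ ≤ C := by
  induction ha using Submodule.span_induction with
  | zero => exact ⟨0, le_rfl, by simp⟩
  | add p q _ _ hp hq =>
    obtain ⟨C, hC, h⟩ := hp
    obtain ⟨D, hD, h'⟩ := hq
    refine ⟨C + D, add_nonneg hC hD, ?_⟩
    filter_upwards [h, h'] with s h1 h2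
    exact (norm_add_le _ _).trans (add_le_add h1 h2)
  | smul c p _ hp =>
    obtain ⟨C, hC, h⟩ := hp
    refine ⟨‖c‖ * C, by positivity, ?_⟩
    filter_upwards [h] with s h1
    rw [Pi.smul_apply, norm_smul]
    gcongr
  | mem p hp =>
    obtain ⟨x, hx, y, hy, rfl⟩ := hp
    have hc : Continuous fun s => ‖x s‖ * ‖y s‖ :=
      (E.continuous_norm x hx).mul (E.continuous_norm y hy)
    refine ⟨‖x t‖ * ‖y t‖ + 1, by positivity, ?_⟩
    filter_upwards [(hc.tendsto t).eventually (Iio_mem_nhds (lt_add_one _))] with s hs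
    rw [norm_rankOne]
    exact le_of_lt hs

theorem isCompactOperator_of_mem_finiteRankSections {a : ∀ t, H t →L[ℂ] H t}
    (ha : a ∈ E.finiteRankSections) (t : T) : IsCompactOperator (a t) := by
  induction ha using Submodule.span_induction with
  | zero => exact isCompactOperator_zero
  | add p q _ _ hp hq => exact hp.add hq
  | smul c p _ hp => exact hp.smul c
  | mem p hp =>
    obtain ⟨x, hx, y, hy, rfl⟩ := hp
    have h : IsCompactOperator (ContinuousLinearMap.toSpanSingleton ℂ (x t)) := by
      refine ⟨_, (isCompact_closedBall (0 : ℂ) 1).image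
        (ContinuousLinearMap.toSpanSingleton ℂ (x t)).continuous, ?_⟩
      exact mem_of_superset (Metric.closedBall_mem_nhds _ one_pos)
        (Set.subset_preimage_image _ _)
    exact h.comp_clm (innerSL ℂ (y t))

variable [∀ t, CompleteSpace (H t)]

theorem finiteRankSections_star_mem {a : ∀ t, H t →L[ℂ] H t} (ha : a ∈ E.finiteRankSections) :
    star a ∈ E.finiteRankSections := by
  induction ha using Submodule.span_induction with
  | zero => simp
  | add p q _ _ hp hq => rw [star_add]; exact Submodule.add_mem _ hp hq
  | smul c p _ hp => rw [star_smul]; exact Submodule.smul_mem _ _ hp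
  | mem p hp =>
    obtain ⟨x, hx, y, hy, rfl⟩ := hp
    refine Submodule.subset_span ⟨y, hy, x, hx, ?_⟩
    funext t
    simp [ContinuousLinearMap.star_eq_adjoint]

theorem isCompactOperator_of_locallyApproximable {a : ∀ t, H t →L[ℂ] H t}
    (ha : LocallyApproximable (E.finiteRankSections : Set (∀ t, H t →L[ℂ] H t)) a) (t : T) :
    IsCompactOperator (a t) := by
  have hcl : IsClosed {f : H t →L[ℂ] H t | IsCompactOperator f} :=
    isClosed_setOfPred_isCompactOperator
  have : a t ∈ closure {f : H t →L[ℂ] H t | IsCompactOperator f} := by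
    rw [Metric.mem_closure_iff]
    intro ε hε
    obtain ⟨b, hb, h⟩ := ha t (ε / 2) (half_pos hε)
    refine ⟨b t, E.isCompactOperator_of_mem_finiteRankSections hb t, ?_⟩
    rw [dist_eq_norm]
    exact lt_of_le_of_lt h.self_of_nhds (half_lt_self hε)
  rwa [hcl.closure_eq] at this

/-- The continuous sections of the continuous field of elementary C*-algebras `(K(H t))`
associated with a continuous field of Hilbert spaces: the families of compact operators that are,
near every point, uniform limits of finite sums of sections `t ↦ θ_{x(t), y(t)}`. -/
def IsContinuousOperatorSection (a : ∀ t, H t →L[ℂ] H t) : Prop :=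
  (∀ t, IsCompactOperator (a t)) ∧
    LocallyApproximable (E.finiteRankSections : Set (∀ t, H t →L[ℂ] H t)) a

theorem isContinuousOperatorSection_mul {a b : ∀ t, H t →L[ℂ] H t}
    (ha : E.IsContinuousOperatorSection a) (hb : E.IsContinuousOperatorSection b) :
    E.IsContinuousOperatorSection (a * b) := by
  refine ⟨fun t => (ha.1 t).comp_clm (b t), fun t ε hε => ?_⟩
  obtain ⟨b₁, hb₁, h₁⟩ := hb.2 t 1 one_pos
  obtain ⟨C, hC, hC'⟩ := E.finiteRankSections_locally_bounded hb₁ t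
  obtain ⟨a', ha', h₂⟩ := ha.2 t (ε / 2 / (C + 1)) (by positivity)
  obtain ⟨D, hD, hD'⟩ := E.finiteRankSections_locally_bounded ha' t
  obtain ⟨b', hb', h₃⟩ := hb.2 t (ε / 2 / (D + 1)) (by positivity)
  refine ⟨a' * b', E.finiteRankSections_mul_mem ha' hb', ?_⟩
  filter_upwards [h₁, hC', h₂, hD', h₃] with s h₁ hC' h₂ hD' h₃
  have hbs : ‖b s‖ ≤ C + 1 := by
    have := norm_add_le (b s - b₁ s) (b₁ s)
    rw [sub_add_cancel] at this
    linarith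
  have e : (a * b) s - (a' * b') s = (a s - a' s) * b s + a' s * (b s - b' s) := by
    simp only [Pi.mul_apply]
    noncomm_ring
  rw [e]
  calc _ ≤ ‖(a s - a' s) * b s‖ + ‖a' s * (b s - b' s)‖ := norm_add_le _ _
    _ ≤ ‖a s - a' s‖ * ‖b s‖ + ‖a' s‖ * ‖b s - b' s‖ :=
        add_le_add (norm_mul_le _ _) (norm_mul_le _ _)
    _ ≤ ε / 2 / (C + 1) * (C + 1) + (D + 1) * (ε / 2 / (D + 1)) := by
        gcongr
        linarith
    _ = ε := by
        have : C + 1 ≠ 0 := by positivity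
        have : D + 1 ≠ 0 := by positivity
        field_simp
        norm_num

/-- The C*-algebra of sections of the continuous field of elementary C*-algebras associated with a
continuous field of Hilbert spaces: the continuous sections whose norm vanishes at infinity, with
pointwise operations. -/
def sectionAlgebra : NonUnitalStarSubalgebra ℂ (∀ t, H t →L[ℂ] H t) where
  carrier := {a | E.IsContinuousOperatorSection a ∧
    Tendsto (fun t => ‖a t‖) (cocompact T) (𝓝 0)}
  zero_mem' := ⟨⟨fun _ => isCompactOperator_zero, fun t ε hε =>
    ⟨0, Submodule.zero_mem _, by simp [hε.le]⟩⟩, by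
      simpa using (tendsto_const_nhds : Tendsto (fun _ : T => (0 : ℝ)) (cocompact T) (𝓝 0))⟩
  add_mem' := by
    rintro a b ⟨ha, ha0⟩ ⟨hb, hb0⟩
    refine ⟨⟨fun t => (ha.1 t).add (hb.1 t), fun t ε hε => ?_⟩, ?_⟩
    · obtain ⟨a', ha', h₁⟩ := ha.2 t (ε / 2) (half_pos hε)
      obtain ⟨b', hb', h₂⟩ := hb.2 t (ε / 2) (half_pos hε)
      refine ⟨a' + b', Submodule.add_mem _ ha' hb', ?_⟩
      filter_upwards [h₁, h₂] with s h₁ h₂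
      have e : (a + b) s - (a' + b') s = (a s - a' s) + (b s - b' s) := by
        simp only [Pi.add_apply]
        abel
      rw [e]
      linarith [norm_add_le (a s - a' s) (b s - b' s)]
    · refine squeeze_zero (fun _ => norm_nonneg _) (fun t => norm_add_le (a t) (b t)) ?_
      simpa using ha0.add hb0
  smul_mem' := by
    rintro c a ⟨ha, ha0⟩
    refine ⟨⟨fun t => (ha.1 t).smul c, fun t ε hε => ?_⟩, ?_⟩
    · obtain ⟨a', ha', h₁⟩ := ha.2 t (ε / (‖c‖ + 1)) (by positivity)
      refine ⟨c • a', Submodule.smul_mem _ _ ha', ?_⟩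
      filter_upwards [h₁] with s h₁
      rw [Pi.smul_apply, Pi.smul_apply, ← smul_sub, norm_smul]
      calc _ ≤ (‖c‖ + 1) * (ε / (‖c‖ + 1)) := by gcongr; linarith
        _ = ε := by
          have : ‖c‖ + 1 ≠ 0 := by positivity
          field_simp
    · simpa [norm_smul] using ha0.const_mul ‖c‖
  mul_mem' := by
    rintro a b ⟨ha, ha0⟩ ⟨hb, hb0⟩
    refine ⟨E.isContinuousOperatorSection_mul ha hb, ?_⟩
    refine squeeze_zero (fun _ => norm_nonneg _) (fun t => norm_mul_le (a t) (b t)) ?_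
    simpa using ha0.mul hb0
  star_mem' := by
    rintro a ⟨ha, ha0⟩
    have h : LocallyApproximable (E.finiteRankSections : Set (∀ t, H t →L[ℂ] H t)) (star a) := by
      intro t ε hε
      obtain ⟨a', ha', h₁⟩ := ha.2 t ε hε
      refine ⟨star a', E.finiteRankSections_star_mem ha', ?_⟩
      filter_upwards [h₁] with s h₁
      rwa [Pi.star_apply, Pi.star_apply, ← star_sub, norm_star]
    exact ⟨⟨E.isCompactOperator_of_locallyApproximable h, h⟩, by simpa using ha0⟩

end ContinuousHilbertField

/-! ### Pure states and the existence of irreducible representations -/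

section PureStates

variable {A : Type u} [CStarAlgebra A] [PartialOrder A] [StarOrderedRing A]

/-! The elements `φ(a)` of the Pedersen ideal approximate every positive `a` in norm,
representations are contractive, and the section algebra is closed under uniform limits. Hence the
assumption on the Pedersen ideal already makes every `a ∈ S` a section.

The map is isometric because the norm of `a` is attained at some irreducible representation: a pure
state norming `a* a` exists by Krein–Milman (`CStarAlgebra.exists_extreme_state`), and its GNS
representation is irreducible. Separability of `S` lets that representation be moved to the universe
in which the spectrum is formed.

Surjectivity is a Stone–Weierstrass argument, `exists_forall_norm_sub_le`. In each fibre the image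
of an ideal not killed there is an irreducible algebra of compact operators, hence dense in the
compacts (`rankOne_mem_topologicalClosure_of_irreducible`). To patch fibrewise approximations,
sections must be multiplied by scalar functions, which is possible up to `ε` by an approximate
Dauns–Hofmann theorem (`exists_norm_smul_sub_le`). Partitions of unity require a locally compact
Hausdorff spectrum. Both properties follow from the continuity of `γ ↦ ‖π γ a‖`, which rests on a
Gram operator formula for the norm of a finite rank operator. Completeness of `S` turns
approximation into equality. -/

theorem CStarAlgebra.norm_one_add_of_nonneg [Nontrivial A] {b : A} (hb : 0 ≤ b) :
    ‖1 + b‖ = 1 + ‖b‖ := by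
  apply le_antisymm
  · simpa using norm_add_le 1 b
  · have h0 : (0 : A) ≤ 1 + b := add_nonneg zero_le_one hb
    have h1 : 1 + b ≤ algebraMap ℝ A ‖1 + b‖ := IsSelfAdjoint.le_algebraMap_norm_self (.of_nonneg h0)
    have h2 : b ≤ algebraMap ℝ A (‖1 + b‖ - 1) := by
      rw [map_sub, map_one]
      exact le_sub_iff_add_le'.mpr h1
    have h3 : ‖b‖ ≤ ‖1 + b‖ - 1 := by
      refine (CStarAlgebra.norm_le_iff_le_algebraMap b ?_ hb).mpr h2
      have : ‖(1 : A)‖ ≤ ‖1 + b‖ :=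
        CStarAlgebra.norm_le_norm_of_nonneg_of_le zero_le_one (le_add_of_nonneg_right hb)
      simpa using this
    linarith

/-- A contractive functional on a unital C*-algebra attaining its norm at `1` is real on
self-adjoint elements. -/
theorem ContinuousLinearMap.im_apply_eq_zero_of_isSelfAdjoint {f : A →L[ℂ] ℂ} (hf : ‖f‖ ≤ 1)
    (h1 : f 1 = 1) {a : A} (ha : IsSelfAdjoint a) : (f a).im = 0 := by
  -- Evaluate `f` at `a + it`: the `t ^ 2` in `|f a + it|²` cancels against `‖a + it‖² ≤ ‖a‖² + t²`,
  -- leaving a linear function of `t` that is bounded above.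
  have key : ∀ t : ℝ, 2 * (f a).im * t ≤ ‖a‖ ^ 2 := by
    intro t
    have e1 : ‖a + (t * Complex.I) • (1 : A)‖ ^ 2 ≤ ‖a‖ ^ 2 + t ^ 2 := by
      rw [sq, ← CStarRing.norm_star_mul_self]
      have : star (a + (t * Complex.I) • (1 : A)) * (a + (t * Complex.I) • (1 : A)) =
          a * a + ((t : ℂ) ^ 2) • (1 : A) := by
        simp only [star_add, ha.star_eq, star_smul, star_one, add_mul, mul_add, smul_mul_assoc,
          one_mul, mul_smul_comm, mul_one]
        have : star ((t : ℂ) * Complex.I) = -(t * Complex.I) := by simp [mul_comm]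
        rw [this, neg_smul]
        have h2 : -(↑t * Complex.I) * (↑t * Complex.I) = (t : ℂ) ^ 2 := by
          ring_nf; simp
        linear_combination (norm := module) h2 • (1 : A)
      rw [this]
      refine (norm_add_le _ _).trans ?_
      gcongr
      · rw [sq]; exact norm_mul_le _ _
      · refine (norm_smul_le _ _).trans ?_
        rcases subsingleton_or_nontrivial A with h | h
        · rw [Subsingleton.elim (1 : A) 0]; simp; positivity
        · simp
    have e2 : f (a + (t * Complex.I) • (1 : A)) = f a + t * Complex.I := by simp [h1]
    have e3 : ‖f a + t * Complex.I‖ ^ 2 ≤ ‖a‖ ^ 2 + t ^ 2 := by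
      rw [← e2]
      refine le_trans ?_ e1
      gcongr
      exact (f.le_opNorm _).trans (mul_le_of_le_one_left (norm_nonneg _) hf)
    rw [← Complex.normSq_eq_norm_sq, Complex.normSq_apply] at e3
    simp at e3
    nlinarith [mul_self_nonneg (f a).re, mul_self_nonneg (f a).im]
  by_contra hne
  have := key ((‖a‖ ^ 2 + 1) / (2 * (f a).im))
  rw [mul_div_cancel₀] at this
  · linarith
  · simpa using hne

-- For positive `a` the element `‖a‖ - a` has norm at most `‖a‖`, so the real part of `‖a‖ - f a` is
-- at most `‖a‖`.
open scoped ComplexOrder in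
theorem ContinuousLinearMap.apply_nonneg_of_map_one {f : A →L[ℂ] ℂ} (hf : ‖f‖ ≤ 1)
    (h1 : f 1 = 1) {a : A} (ha : 0 ≤ a) : 0 ≤ f a := by
  rw [Complex.nonneg_iff]
  refine ⟨?_, (f.im_apply_eq_zero_of_isSelfAdjoint hf h1 (.of_nonneg ha)).symm⟩
  have hle : ‖algebraMap ℝ A ‖a‖ - a‖ ≤ ‖a‖ := by
    have h2 : a ≤ algebraMap ℝ A ‖a‖ := IsSelfAdjoint.le_algebraMap_norm_self (.of_nonneg ha)
    refine (CStarAlgebra.norm_le_iff_le_algebraMap _ (norm_nonneg _) (sub_nonneg.mpr h2)).mpr ?_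
    exact sub_le_self _ ha
  have h3 : ‖f (algebraMap ℝ A ‖a‖ - a)‖ ≤ ‖a‖ :=
    (f.le_opNorm _).trans ((mul_le_of_le_one_left (norm_nonneg _) hf).trans hle)
  have h4 : f (algebraMap ℝ A ‖a‖ - a) = ‖a‖ - f a := by
    rw [map_sub, IsScalarTower.algebraMap_apply ℝ ℂ A, Algebra.algebraMap_eq_smul_one, map_smul, h1]
    simp
  rw [h4] at h3
  have := (Complex.re_le_norm _).trans h3
  simp at this
  exact this

/-- The closed unit ball of the dual has an extreme point which is a state attaining the norm of a
given positive element. -/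
theorem CStarAlgebra.exists_extreme_state [Nontrivial A] {b : A} (hb : 0 ≤ b) :
    ∃ f : A →L[ℂ] ℂ, ‖f‖ ≤ 1 ∧ f 1 = 1 ∧ f b = ‖b‖ ∧
      ∀ g h : A →L[ℂ] ℂ, ‖g‖ ≤ 1 → ‖h‖ ≤ 1 → ∀ t : ℝ, 0 < t → t < 1 →
        f = t • g + (1 - t) • h → g = f := by
  let K : Set (WeakDual ℂ A) := WeakDual.toStrongDual ⁻¹' Metric.closedBall 0 1
  have hK : IsCompact K := WeakDual.isCompact_closedBall (𝕜 := ℂ) (E := A) 0 1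
  have hKmem : ∀ f : WeakDual ℂ A, f ∈ K ↔ ‖WeakDual.toStrongDual f‖ ≤ 1 := fun f => by
    simp [K]
  have hKle : ∀ f ∈ K, ∀ a : A, ‖f a‖ ≤ ‖a‖ := fun f hf a =>
    ((WeakDual.toStrongDual f).le_opNorm a).trans
      (mul_le_of_le_one_left (norm_nonneg _) ((hKmem f).mp hf))
  -- As `‖1 + b‖ = 1 + ‖b‖`, norming `1 + b` forces both `f 1 = 1` and `f b = ‖b‖`.
  let F : Set (WeakDual ℂ A) := K ∩ {f | f (1 + b) = ‖1 + b‖}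
  have hFcl : IsClosed {f : WeakDual ℂ A | f (1 + b) = ‖1 + b‖} :=
    isClosed_eq (WeakDual.eval_continuous _) continuous_const
  have hF : IsCompact F := hK.inter_right hFcl
  have hFne : F.Nonempty := by
    obtain ⟨g, hg1, hg⟩ := exists_dual_vector'' ℂ (1 + b)
    exact ⟨StrongDual.toWeakDual g, by simpa [K] using hg1, hg⟩
  have : LocallyConvexSpace ℝ (WeakDual ℂ A) :=
    WeakBilin.locallyConvexSpace (𝕜 := ℂ) (E := A →L[ℂ] ℂ) (F := A) (B := topDualPairing ℂ A)
  obtain ⟨f, hf⟩ := hF.extremePoints_nonempty hFne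
  obtain ⟨⟨hfK, hfb⟩, hext⟩ := hf
  have hfb : f (1 + b) = ‖1 + b‖ := hfb
  rw [CStarAlgebra.norm_one_add_of_nonneg hb, map_add] at hfb
  have n1 : (f 1).re ≤ 1 := by
    simpa using (Complex.re_le_norm _).trans (hKle f hfK 1)
  have nb : (f b).re ≤ ‖b‖ := (Complex.re_le_norm _).trans (hKle f hfK b)
  have hre := congrArg Complex.re hfb
  simp at hre
  have aux : ∀ (z : ℂ) (r : ℝ), ‖z‖ ≤ r → z.re = r → z = r := by
    intro z r hz hr
    have h0 : 0 ≤ r := (norm_nonneg z).trans hz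
    apply Complex.ext
    · simpa using hr
    · have h1 : ‖z‖ ^ 2 ≤ r ^ 2 := by gcongr
      rw [← Complex.normSq_eq_norm_sq, Complex.normSq_apply, hr] at h1
      have : z.im * z.im ≤ 0 := by nlinarith
      simpa using le_antisymm this (mul_self_nonneg _)
  have f1 : f 1 = 1 := by
    simpa using aux (f 1) 1 (by simpa using hKle f hfK 1) (by linarith)
  have fb : f b = ‖b‖ := aux _ _ (hKle f hfK b) (by rw [f1] at hre; simpa using hre)
  refine ⟨WeakDual.toStrongDual f, (hKmem f).mp hfK, f1, fb, ?_⟩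
  intro g h hg hh t ht0 ht1 e
  have hgK : StrongDual.toWeakDual g ∈ K := (hKmem _).mpr hg
  have hhK : StrongDual.toWeakDual h ∈ K := (hKmem _).mpr hh
  have e' : ∀ a, f a = t * g a + (1 - t) * h a := by
    intro a
    have := congrArg (fun φ : A →L[ℂ] ℂ => φ a) e
    simpa using this
  have rg : (g (1 + b)).re ≤ ‖1 + b‖ := (Complex.re_le_norm _).trans (hKle _ hgK _)
  have rh : (h (1 + b)).re ≤ ‖1 + b‖ := (Complex.re_le_norm _).trans (hKle _ hhK _)
  have e1 := congrArg Complex.re (e' (1 + b))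
  rw [map_add, hfb, ← CStarAlgebra.norm_one_add_of_nonneg hb] at e1
  have e1 : ‖1 + b‖ = t * (g (1 + b)).re + (1 - t) * (h (1 + b)).re := by
    simpa using e1
  -- `F` is a face of the ball: a proper convex combination of reals that are at most `‖1 + b‖`
  -- reaches this value only if both do. So extremality in `F` gives extremality in `K`.
  have hgF : StrongDual.toWeakDual g ∈ F := by
    refine ⟨hgK, aux _ _ (hKle _ hgK _) ?_⟩
    change (g (1 + b)).re = _
    nlinarith
  have hhF : StrongDual.toWeakDual h ∈ F := by
    refine ⟨hhK, aux _ _ (hKle _ hhK _) ?_⟩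
    change (h (1 + b)).re = _
    nlinarith
  have := hext hgF hhF ⟨t, 1 - t, ht0, by linarith, by ring, by
    refine DFunLike.ext _ _ fun a => ?_
    change t • g a + (1 - t) • h a = f a
    rw [e' a]; simp⟩
  rw [← this]
  rfl

end PureStates

/-! ### Irreducible representations: restriction to ideals and density of orbits -/

section Irreducible

variable {A : Type u} [NonUnitalCStarAlgebra A] {H : Type v} [NormedAddCommGroup H]
    [InnerProductSpace ℂ H] [CompleteSpace H] {ρ : A →⋆ₙₐ[ℂ] (H →L[ℂ] H)}

/-- The restriction of an irreducible representation to an ideal on which it does not vanish is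
irreducible. -/
theorem IsIrreducibleRep.eq_bot_or_eq_top_of_ideal (hρ : IsIrreducibleRep ρ) {J : Set A}
    (hl : ∀ a, ∀ s ∈ J, a * s ∈ J) (hr : ∀ a, ∀ s ∈ J, s * a ∈ J) (hne : ∃ s ∈ J, ρ s ≠ 0)
    {K : Submodule ℂ H} (hKc : IsClosed (K : Set H)) (hK : ∀ s ∈ J, ∀ ξ ∈ K, ρ s ξ ∈ K) :
    K = ⊥ ∨ K = ⊤ := by
  -- The common null space of `J` is invariant under all of `A`, and proper since `ρ` does not
  -- vanish on `J`; hence it is zero.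
  let Z : Submodule ℂ H := ⨅ s ∈ J, LinearMap.ker (ρ s).toLinearMap
  have hZ : ∀ ξ, ξ ∈ Z ↔ ∀ s ∈ J, ρ s ξ = 0 := by
    intro ξ
    simp [Z, Submodule.mem_iInf]
  have hZc : IsClosed (Z : Set H) := by
    have : (Z : Set H) = ⋂ s ∈ J, {ξ | ρ s ξ = 0} := by
      ext ξ; simp [hZ]
    rw [this]
    exact isClosed_biInter fun s _ => isClosed_eq (ρ s).continuous continuous_const
  have hZ0 : Z = ⊥ := by
    refine (hρ.2 Z hZc fun a ξ hξ => ?_).resolve_right fun h => ?_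
    · rw [hZ] at hξ ⊢
      intro s hs
      simpa using hξ _ (hr a s hs)
    · obtain ⟨s, hs, h0⟩ := hne
      apply h0
      ext ξ
      have : ξ ∈ Z := by rw [h]; trivial
      simpa using (hZ ξ).mp this s hs
  -- The span of `ρ(J)K` lies in `K` and is invariant under all of `A`. If its closure is zero then
  -- `K ≤ Z = ⊥`; otherwise `K` is everything.
  let L₀ : Submodule ℂ H := Submodule.span ℂ {η | ∃ s ∈ J, ∃ ξ ∈ K, ρ s ξ = η}
  have hL₀K : L₀ ≤ K := by
    refine Submodule.span_le.mpr ?_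
    rintro _ ⟨s, hs, ξ, hξ, rfl⟩
    exact hK s hs ξ hξ
  have hLK : L₀.topologicalClosure ≤ K := L₀.topologicalClosure_minimal hL₀K hKc
  have hinv : ∀ a : A, ∀ η ∈ L₀, ρ a η ∈ L₀ := by
    intro a η hη
    induction hη using Submodule.span_induction with
    | zero => simp
    | add x y _ _ hx hy => rw [map_add]; exact add_mem hx hy
    | smul c x _ hx => rw [map_smul]; exact Submodule.smul_mem _ _ hx
    | mem x hx =>
      obtain ⟨s, hs, ξ, hξ, rfl⟩ := hx
      exact Submodule.subset_span ⟨a * s, hl a s hs, ξ, hξ, by simp⟩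
  rcases hρ.2 L₀.topologicalClosure L₀.isClosed_topologicalClosure (fun a ξ hξ =>
      map_mem_closure (ρ a).continuous hξ (hinv a)) with h | h
  · left
    rw [eq_bot_iff, ← hZ0]
    intro ξ hξ
    rw [hZ]
    intro s hs
    have : ρ s ξ ∈ L₀.topologicalClosure :=
      L₀.le_topologicalClosure (Submodule.subset_span ⟨s, hs, ξ, hξ, rfl⟩)
    rw [h] at this
    exact this
  · right
    rw [eq_top_iff, ← h]
    exact hLK

/-- The orbit is an invariant subspace. Without a unit it might be zero; but then the line through
`ξ` is invariant, hence the whole space, and `ρ = 0`. -/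
theorem IsIrreducibleRep.dense_orbit (hρ : IsIrreducibleRep ρ) {ξ : H} (hξ : ξ ≠ 0) :
    Dense (Set.range fun a => ρ a ξ) := by
  let L₀ : Submodule ℂ H := LinearMap.range
    ({ toFun := fun a => ρ a ξ, map_add' := by simp, map_smul' := by simp } : A →ₗ[ℂ] H)
  have hL₀ : (L₀ : Set H) = Set.range fun a => ρ a ξ := rfl
  have hinv : ∀ a : A, ∀ η ∈ L₀, ρ a η ∈ L₀ := by
    rintro a _ ⟨b, rfl⟩
    exact ⟨a * b, by simp⟩
  rcases hρ.2 L₀.topologicalClosure L₀.isClosed_topologicalClosure (fun a η hη =>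
      map_mem_closure (ρ a).continuous hη (hinv a)) with h | h
  · exfalso
    have h0 : ∀ a, ρ a ξ = 0 := fun a => by
      have : ρ a ξ ∈ L₀.topologicalClosure := L₀.le_topologicalClosure ⟨a, rfl⟩
      rwa [h] at this
    have hc : IsClosed ((ℂ ∙ ξ : Submodule ℂ H) : Set H) := Submodule.closed_of_finiteDimensional _
    rcases hρ.2 (ℂ ∙ ξ) hc (fun a η hη => by
      obtain ⟨c, rfl⟩ := Submodule.mem_span_singleton.mp hη
      simp [h0]) with h | h
    · exact hξ (by simpa using h)
    · apply hρ.1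
      ext a η
      have : η ∈ (ℂ ∙ ξ : Submodule ℂ H) := by rw [h]; trivial
      obtain ⟨c, rfl⟩ := Submodule.mem_span_singleton.mp this
      simp [h0]
  · rw [← hL₀]
    intro x
    have : x ∈ L₀.topologicalClosure := by rw [h]; trivial
    exact this

end Irreducible

/-! ### The GNS representation of a pure state -/

section GNS

variable {A : Type u} [CStarAlgebra A] [PartialOrder A] [StarOrderedRing A]

/-- The norm of a positive element of a unital C*-algebra is the value of a vector state of an
irreducible representation, namely the GNS representation of a pure state. -/
theorem CStarAlgebra.exists_irreducibleRep_one [Nontrivial A] {b : A} (hb : 0 ≤ b) :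
    ∃ ρ : IrreducibleRep.{u, u} A, ρ.rep 1 = 1 ∧ ∃ ξ : ρ.space, ‖ξ‖ = 1 ∧
      inner ℂ ξ (ρ.rep b ξ) = ‖b‖ := by
  obtain ⟨f, hf, hf1, hfb, hext⟩ := CStarAlgebra.exists_extreme_state hb
  open scoped ComplexOrder in
  let φ : A →ₚ[ℂ] ℂ := .mk₀ f.toLinearMap fun a ha => f.apply_nonneg_of_map_one hf hf1 ha
  let H := φ.GNS
  let ρ := φ.gnsStarAlgHom
  let ξ : H := (φ.toPreGNS 1 : φ.GNS)
  have hρξ : ∀ a, ρ a ξ = (φ.toPreGNS a : φ.GNS) := fun a => by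
    simp [ρ, ξ]
  have hinner : ∀ a c, inner ℂ (ρ a ξ) (ρ c ξ) = f (star a * c) := fun a c => by
    rw [hρξ, hρξ, UniformSpace.Completion.inner_coe]
    rfl
  have hρ1 : ρ 1 = 1 := map_one ρ
  have hstate : ∀ a, inner ℂ ξ (ρ a ξ) = f a := fun a => by
    have := hinner 1 a
    rwa [hρ1, star_one, one_mul] at this
  have hξ : ‖ξ‖ = 1 := by
    have h := hstate 1
    rw [hρ1, hf1] at h
    have h' : inner ℂ ξ ξ = (1 : ℂ) := h
    rw [inner_self_eq_norm_sq_to_K] at h'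
    have h2 : ‖ξ‖ ^ 2 = 1 := Complex.ofReal_injective (by simpa using h')
    exact (pow_eq_one_iff_of_nonneg (norm_nonneg _) two_ne_zero).mp h2
  have hdense : DenseRange fun a => ρ a ξ := by
    have : (fun a => ρ a ξ) = fun a => (φ.toPreGNS a : φ.GNS) := funext hρξ
    rw [this]
    exact UniformSpace.Completion.denseRange_coe.comp φ.toPreGNS.surjective.denseRange
      (UniformSpace.Completion.continuous_coe _)
  have hstar : ∀ a (x y : H), inner ℂ (ρ a x) y = inner ℂ x (ρ (star a) y) := fun a x y => by
    rw [map_star, ContinuousLinearMap.star_eq_adjoint, ContinuousLinearMap.adjoint_inner_right]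
  have hirr : IsIrreducibleRep (ρ : A →⋆ₙₐ[ℂ] (H →L[ℂ] H)) := by
    refine ⟨fun h => ?_, fun K hKc hK => ?_⟩
    · have h2 : ρ 1 ξ = 0 := by
        have := congrArg (fun σ : A →⋆ₙₐ[ℂ] (H →L[ℂ] H) => σ 1 ξ) h
        exact this
      rw [hρ1] at h2
      have h3 : ξ = 0 := h2
      rw [h3] at hξ
      simp at hξ
    · have : CompleteSpace K := hKc.completeSpace_coe
      let P := K.starProjection
      have hPK : ∀ x, P x ∈ K := fun x => K.starProjection_apply_mem x
      have hPsa : ∀ x y, inner ℂ (P x) y = inner ℂ x (P y) := fun x y =>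
        K.inner_starProjection_left_eq_right x y
      have hPid : ∀ x ∈ K, P x = x := fun x hx => Submodule.starProjection_eq_self_iff.mpr hx
      have hcomm : ∀ a x, P (ρ a x) = ρ a (P x) := by
        intro a x
        have h1 : ∀ a x, P (ρ a (P x)) = ρ a (P x) := fun a x => hPid _ (hK a _ (hPK x))
        refine ext_inner_right ℂ fun y => ?_
        rw [hPsa, hstar, ← h1 (star a), ← hPsa, ← hstar, ← hPsa, h1]
      -- Split the cyclic vector along the reducing subspace `K`. If both parts are nonzero, `f` is
      -- a convex combination of the normalized vector functionals of `η` and `ζ`. Extremality and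
      -- cyclicity give `η = ‖η‖² ξ`, and applying `P` gives `‖η‖ = 1`, against `ζ ≠ 0`.
      obtain ⟨η, hη⟩ : ∃ η, η = P ξ := ⟨_, rfl⟩
      obtain ⟨ζ, hζ⟩ : ∃ ζ, ζ = ξ - P ξ := ⟨_, rfl⟩
      have hsum : ξ = η + ζ := by rw [hη, hζ]; abel
      have hPη : P η = η := by rw [hη]; exact hPid _ (hPK ξ)
      have hPζ : P ζ = 0 := by rw [hζ, map_sub, ← hη, hPη, sub_self]
      have c1 : ∀ a, inner ℂ η (ρ a ζ) = 0 := fun a => by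
        rw [← hPη, hPsa, hcomm, hPζ, map_zero, inner_zero_right]
      have c2 : ∀ a, inner ℂ ζ (ρ a η) = 0 := fun a => by
        rw [← hPη, ← hcomm, ← hPsa, hPζ, inner_zero_left]
      have hsplit : ∀ a, f a = inner ℂ η (ρ a η) + inner ℂ ζ (ρ a ζ) := fun a => by
        rw [← hstate, hsum, map_add, inner_add_left, inner_add_right, inner_add_right, c1, c2]
        ring
      have hzero : ∀ x, (∀ a, inner ℂ x (ρ a ξ) = 0) → x = 0 := fun x hx =>
        hdense.eq_zero_of_inner_left ℂ hx
      by_cases hη0 : η = 0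
      · left
        rw [eq_bot_iff]
        intro x hx
        refine hzero x fun a => ?_
        rw [← hPid x hx, hPsa, hcomm, ← hη, hη0, map_zero, inner_zero_right]
      by_cases hζ0 : ζ = 0
      · right
        rw [eq_top_iff]
        intro x _
        have hξK : ξ ∈ K := by
          rw [hsum, hζ0, add_zero, hη]
          exact hPK ξ
        have : closure (Set.range fun a => ρ a ξ) ⊆ K := by
          refine hKc.closure_subset_iff.mpr ?_
          rintro _ ⟨a, rfl⟩
          exact hK a ξ hξK
        exact this (hdense x)
      exfalso
      have hω : ∀ x : H, ∃ ω : A →L[ℂ] ℂ, ‖ω‖ ≤ ‖x‖ ^ 2 ∧ ∀ a, ω a = inner ℂ x (ρ a x) := by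
        intro x
        refine ⟨LinearMap.mkContinuous
          { toFun := fun a => inner ℂ x (ρ a x)
            map_add' := fun a c => by
              rw [map_add, _root_.add_apply, inner_add_right]
            map_smul' := fun c a => by
              rw [map_smul, _root_.smul_apply, inner_smul_right]; rfl }
          (‖x‖ ^ 2) fun a => ?_, LinearMap.mkContinuous_norm_le _ (by positivity) _, fun a => rfl⟩
        have h0 : ‖inner ℂ x (ρ a x)‖ ≤ ‖x‖ * ‖ρ a x‖ := norm_inner_le_norm _ _
        refine h0.trans ?_
        have h1 : ‖ρ a x‖ ≤ ‖a‖ * ‖x‖ := ((ρ a).le_opNorm x).trans <| by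
          gcongr
          exact NonUnitalStarAlgHom.norm_apply_le ρ a
        calc _ ≤ ‖x‖ * (‖a‖ * ‖x‖) := by gcongr
          _ = _ := by ring
      obtain ⟨g, hg, hg'⟩ := hω η
      obtain ⟨h, hh, hh'⟩ := hω ζ
      have hη1 : 0 < ‖η‖ ^ 2 := by positivity
      have hζ1 : 0 < ‖ζ‖ ^ 2 := by positivity
      have ht : ‖η‖ ^ 2 + ‖ζ‖ ^ 2 = 1 := by
        have h1 := hsplit 1
        rw [hρ1, hf1] at h1
        have h2 : (1 : ℂ) = inner ℂ η η + inner ℂ ζ ζ := h1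
        rw [inner_self_eq_norm_sq_to_K, inner_self_eq_norm_sq_to_K] at h2
        exact Complex.ofReal_injective (by simpa using h2.symm)
      have hnorm : ∀ (ω : A →L[ℂ] ℂ) (r : ℝ), 0 < r → ‖ω‖ ≤ r → ‖r⁻¹ • ω‖ ≤ 1 := by
        intro ω r hr hω
        rw [norm_smul, norm_inv, Real.norm_of_nonneg hr.le, inv_mul_le_iff₀ hr, mul_one]
        exact hω
      have key := hext ((‖η‖ ^ 2)⁻¹ • g) ((‖ζ‖ ^ 2)⁻¹ • h) (hnorm _ _ hη1 hg)
        (hnorm _ _ hζ1 hh) (‖η‖ ^ 2) hη1 (by linarith) (by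
          rw [show 1 - ‖η‖ ^ 2 = ‖ζ‖ ^ 2 by linarith, smul_inv_smul₀ hη1.ne',
            smul_inv_smul₀ hζ1.ne']
          ext a
          rw [_root_.add_apply, hg', hh', hsplit])
      have hgf : ∀ a, inner ℂ η (ρ a η) = ((‖η‖ ^ 2 : ℝ) : ℂ) * f a := fun a => by
        rw [← key, ← hg']
        have : g a = (‖η‖ ^ 2 : ℝ) • ((‖η‖ ^ 2)⁻¹ • g) a := by
          rw [_root_.smul_apply, smul_inv_smul₀ hη1.ne']
        rw [this]
        simp
      have hηξ : η = ((‖η‖ ^ 2 : ℝ) : ℂ) • ξ := by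
        rw [← sub_eq_zero]
        refine hzero _ fun a => ?_
        rw [inner_sub_left, inner_smul_left, hstate, Complex.conj_ofReal, ← hgf, hsum, map_add,
          inner_add_right, c1, add_zero, sub_self]
      have h5 : η = ((‖η‖ ^ 2 : ℝ) : ℂ) • η := by
        conv_lhs => rw [← hPη, hηξ, map_smul, ← hη]
      have h6 : (1 - ((‖η‖ ^ 2 : ℝ) : ℂ)) • η = 0 := by
        rw [sub_smul, one_smul, ← h5, sub_self]
      rcases smul_eq_zero.mp h6 with h7 | h7
      · have : (1 : ℝ) = ‖η‖ ^ 2 := Complex.ofReal_injective (by simpa using sub_eq_zero.mp h7)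
        linarith
      · exact hη0 h7
  exact ⟨⟨H, ρ, hirr⟩, hρ1, ξ, hξ, (hstate b).trans hfb⟩

end GNS

/-! ### Irreducible representations attain norms; change of universe -/

section Separation

variable {A : Type u} [NonUnitalCStarAlgebra A]

theorem NonUnitalStarAlgHom.continuous_of_cstar {B : Type v} [NonUnitalCStarAlgebra B]
    (φ : A →⋆ₙₐ[ℂ] B) : Continuous φ :=
  AddMonoidHomClass.continuous_of_bound φ 1 fun a => by
    simpa using NonUnitalStarAlgHom.norm_apply_le φ a

/-- The norm of an element of a C*-algebra is attained at an irreducible representation. -/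
theorem exists_irreducibleRep_norm_eq {a : A} (ha : a ≠ 0) :
    ∃ ρ : IrreducibleRep.{u, u} A, ‖ρ.rep a‖ = ‖a‖ := by
  let B := Unitization ℂ A
  let _ : PartialOrder B := CStarAlgebra.spectralOrder B
  let _ : StarOrderedRing B := CStarAlgebra.spectralOrderedRing B
  let j : A →⋆ₙₐ[ℂ] B := Unitization.inrNonUnitalStarAlgHom ℂ A
  have hj : ∀ x, ‖j x‖ = ‖x‖ := fun x => Unitization.norm_inr (𝕜 := ℂ) x
  -- Pass to the unitization, where a vector state of `a* a` computes `‖σ(a) ξ‖²`. Since `A` is an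
  -- ideal there, the restriction of `σ` stays irreducible.
  obtain ⟨σ, hσ1, ξ, hξ, hb⟩ :=
    CStarAlgebra.exists_irreducibleRep_one (star_mul_self_nonneg (j a))
  have hnorm : ‖σ.rep (j a) ξ‖ = ‖a‖ := by
    rw [map_mul, map_star, ContinuousLinearMap.star_eq_adjoint, mul_apply_eq_comp,
      ContinuousLinearMap.adjoint_inner_right, CStarRing.norm_star_mul_self,
      inner_self_eq_norm_sq_to_K, hj] at hb
    have h2 : ‖σ.rep (j a) ξ‖ ^ 2 = ‖a‖ ^ 2 := by
      rw [sq ‖a‖]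
      exact Complex.ofReal_injective (by simpa using hb)
    exact (pow_left_inj₀ (norm_nonneg _) (norm_nonneg _) two_ne_zero).mp h2
  have hle : ‖σ.rep (j a)‖ = ‖a‖ := by
    apply le_antisymm
    · rw [← hj]
      exact NonUnitalStarAlgHom.norm_apply_le _ _
    · rw [← hnorm]
      simpa [hξ] using (σ.rep (j a)).le_opNorm ξ
  have hl : ∀ b : B, ∀ s ∈ Set.range j, b * s ∈ Set.range j := by
    rintro b _ ⟨s, rfl⟩
    induction b using Unitization.ind with
    | inl_add_inr r x =>
      refine ⟨r • s + x * s, ?_⟩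
      change ((r • s + x * s : A) : B) = (Unitization.inl r + (x : B)) * (s : B)
      rw [add_mul, Unitization.inl_mul_inr, ← Unitization.inr_mul, ← Unitization.inr_add]
  have hr : ∀ b : B, ∀ s ∈ Set.range j, s * b ∈ Set.range j := by
    rintro b _ ⟨s, rfl⟩
    obtain ⟨x, hx⟩ := hl (star b) (star (j s)) ⟨star s, map_star j s⟩
    exact ⟨star x, by rw [map_star, hx, star_mul, star_star, star_star]⟩
  have hne : σ.rep (j a) ≠ 0 := fun h => ha (by
    rw [h, norm_zero] at hle
    exact norm_eq_zero.mp hle.symm)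
  refine ⟨⟨σ.space, σ.rep.comp j, fun h => hne ?_, fun K hKc hK => ?_⟩, hle⟩
  · exact congrArg (fun φ : A →⋆ₙₐ[ℂ] (σ.space →L[ℂ] σ.space) => φ a) h
  · refine σ.irreducible.eq_bot_or_eq_top_of_ideal hl hr ⟨j a, ⟨a, rfl⟩, hne⟩ hKc ?_
    rintro _ ⟨s, rfl⟩ ξ hξ
    exact hK s ξ hξ

theorem Orthonormal.countable_of_separableSpace {H : Type v} [NormedAddCommGroup H]
    [InnerProductSpace ℂ H] [TopologicalSpace.SeparableSpace H] {ι : Type w} {e : ι → H}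
    (he : Orthonormal ℂ e) : Countable ι := by
  refine Pairwise.countable_of_isOpen_disjoint (s := fun i => Metric.ball (e i) (1 / 2)) ?_
    (fun i => Metric.isOpen_ball) (fun i => ⟨e i, Metric.mem_ball_self (by norm_num)⟩)
  intro i j hij
  refine Metric.ball_disjoint_ball ?_
  rw [dist_eq_norm]
  have h : ‖e i - e j‖ ^ 2 = 2 := by
    rw [@norm_sub_sq ℂ, he.2 hij, he.1, he.1]
    norm_num
  nlinarith [norm_nonneg (e i - e j)]

/-- A separable Hilbert space is isometric to one in any given universe. -/
theorem exists_linearIsometryEquiv_of_separableSpace (H : Type w) [NormedAddCommGroup H]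
    [InnerProductSpace ℂ H] [CompleteSpace H] [TopologicalSpace.SeparableSpace H] :
    ∃ (ι : Type v), Nonempty (H ≃ₗᵢ[ℂ] lp (fun _ : ι => ℂ) 2) := by
  obtain ⟨s, b, hb⟩ := exists_hilbertBasis ℂ H
  have := b.orthonormal.countable_of_separableSpace
  obtain ⟨f, hf⟩ := exists_injective_nat s
  -- A countable index set is replaced by a set of naturals, which lifts to any universe.
  let e : s ≃ ULift.{v} (Set.range f) := (Equiv.ofInjective f hf).trans Equiv.ulift.symm
  refine ⟨ULift.{v} (Set.range f), ⟨(HilbertBasis.mk (v := b ∘ e.symm)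
    (b.orthonormal.comp _ e.symm.injective) ?_).repr⟩⟩
  rw [e.symm.surjective.range_comp, b.dense_span]

theorem IrreducibleRep.exists_transport (ρ : IrreducibleRep.{u, w} A) {K : Type v}
    [NormedAddCommGroup K] [InnerProductSpace ℂ K] [CompleteSpace K] (U : ρ.space ≃ₗᵢ[ℂ] K) :
    ∃ σ : A →⋆ₙₐ[ℂ] (K →L[ℂ] K), IsIrreducibleRep σ ∧ ∀ a x, U (ρ.rep a x) = σ a (U x) := by
  let σ : A →⋆ₙₐ[ℂ] (K →L[ℂ] K) :=
    { toFun := fun a => U.conjStarAlgEquiv (ρ.rep a)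
      map_smul' := fun c a => by ext x; simp
      map_zero' := by rw [map_zero, map_zero]
      map_add' := fun a b => by rw [map_add, map_add]
      map_mul' := fun a b => by rw [map_mul, map_mul]
      map_star' := fun a => by rw [map_star, map_star] }
  have hσ : ∀ a x, σ a x = U (ρ.rep a (U.symm x)) := fun a x => rfl
  refine ⟨σ, ⟨fun h => ρ.irreducible.1 ?_, fun L hLc hL => ?_⟩, fun a x => by simp [hσ]⟩
  · ext a x
    have h2 := hσ a (U x)
    rw [h] at h2
    simpa using h2.symm
  · have hinv : ∀ a : A, ∀ x ∈ L.comap U.toLinearEquiv.toLinearMap,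
        ρ.rep a x ∈ L.comap U.toLinearEquiv.toLinearMap := by
      intro a x hx
      have h : U (ρ.rep a (U.symm (U x))) ∈ L := hL a (U x) hx
      simpa using h
    rcases ρ.irreducible.2 (L.comap U.toLinearEquiv.toLinearMap)
      (hLc.preimage U.continuous) hinv with h | h
    · left
      rw [eq_bot_iff]
      intro x hx
      have : U.symm x ∈ L.comap U.toLinearEquiv.toLinearMap := by simpa using hx
      rw [h] at this
      simpa using this
    · right
      rw [eq_top_iff]
      intro x _
      have : U.symm x ∈ L.comap U.toLinearEquiv.toLinearMap := by rw [h]; trivial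
      simpa using this

/-- An irreducible representation of a separable C*-algebra is unitarily equivalent to one in any
given universe. -/
theorem IrreducibleRep.exists_equiv_universe [TopologicalSpace.SeparableSpace A]
    (ρ : IrreducibleRep.{u, w} A) : ∃ σ : IrreducibleRep.{u, v} A,
      ∃ U : ρ.space ≃ₗᵢ[ℂ] σ.space, ∀ a x, U (ρ.rep a x) = σ.rep a (U x) := by
  obtain ⟨ξ, hξ⟩ : ∃ ξ : ρ.space, ξ ≠ 0 := by
    by_contra! h
    refine ρ.irreducible.1 ?_
    ext a x
    rw [h x]
    simp
  have hsep : TopologicalSpace.SeparableSpace ρ.space := by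
    have hd : DenseRange fun a => ρ.rep a ξ := ρ.irreducible.dense_orbit hξ
    refine hd.separableSpace ?_
    have : Continuous ρ.rep := ρ.rep.continuous_of_cstar
    fun_prop
  obtain ⟨ι, ⟨U⟩⟩ := exists_linearIsometryEquiv_of_separableSpace.{v, w} ρ.space
  obtain ⟨σ, hσ, hU⟩ := ρ.exists_transport U
  exact ⟨⟨lp (fun _ : ι => ℂ) 2, σ, hσ⟩, U, hU⟩

theorem norm_eq_of_unitary_equiv {H : Type v} [NormedAddCommGroup H] [InnerProductSpace ℂ H]
    {K : Type w} [NormedAddCommGroup K] [InnerProductSpace ℂ K] (U : H ≃ₗᵢ[ℂ] K) {S : H →L[ℂ] H}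
    {T : K →L[ℂ] K} (h : ∀ x, U (S x) = T (U x)) : ‖S‖ = ‖T‖ := by
  apply le_antisymm
  · refine S.opNorm_le_bound (norm_nonneg _) fun x => ?_
    rw [← U.norm_map (S x), h, ← U.norm_map x]
    exact T.le_opNorm _
  · refine T.opNorm_le_bound (norm_nonneg _) fun x => ?_
    obtain ⟨y, rfl⟩ := U.surjective x
    rw [← h, U.norm_map, U.norm_map]
    exact S.le_opNorm _

/-- If `π` is a choice of representatives of the spectrum of a separable C*-algebra, then the norm
of every element is attained at some point. -/
theorem CStarSpectrum.exists_norm_eq [TopologicalSpace.SeparableSpace A]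
    {H : CStarSpectrum.{u, v} A → Type v} [∀ γ, NormedAddCommGroup (H γ)]
    [∀ γ, InnerProductSpace ℂ (H γ)] [∀ γ, CompleteSpace (H γ)]
    (π : ∀ γ, A →⋆ₙₐ[ℂ] (H γ →L[ℂ] H γ)) (hirr : ∀ γ, IsIrreducibleRep (π γ))
    (hπ : ∀ γ, CStarSpectrum.mk (π γ) (hirr γ) = γ) {a : A} (ha : a ≠ 0) :
    ∃ γ, ‖π γ a‖ = ‖a‖ := by
  obtain ⟨ρ, hρ⟩ := exists_irreducibleRep_norm_eq ha
  obtain ⟨σ, U, hU⟩ := IrreducibleRep.exists_equiv_universe.{u, v, u} ρ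
  let γ : CStarSpectrum.{u, v} A := CStarSpectrum.mk σ.rep σ.irreducible
  obtain ⟨V, hV⟩ := Quotient.exact (hπ γ)
  refine ⟨γ, ?_⟩
  rw [← hρ, norm_eq_of_unitary_equiv U (hU a)]
  exact norm_eq_of_unitary_equiv V (hV a)

end Separation

/-! ### Irreducible algebras of compact operators -/

section CompactOperators

variable {H : Type v} [NormedAddCommGroup H] [InnerProductSpace ℂ H] [CompleteSpace H]

/-- The norm of a nonzero positive compact operator is an eigenvalue. -/
theorem IsCompactOperator.exists_eigenvector_norm {T : H →L[ℂ] H} (hT : IsCompactOperator T)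
    (h0 : 0 ≤ T) (hne : T ≠ 0) : ∃ x, x ≠ 0 ∧ T x = (‖T‖ : ℂ) • x := by
  have : Nontrivial (H →L[ℂ] H) := ⟨T, 0, hne⟩
  have hs : ‖T‖ ∈ spectrum ℝ T := CStarAlgebra.norm_mem_spectrum_of_nonneg h0
  have hs' : (‖T‖ : ℂ) ∈ spectrum ℂ T := by
    simpa using spectrum.algebraMap_mem ℂ hs
  have hev := (hT.hasEigenvalue_iff_mem_spectrum (by simpa using hne)).mpr hs'
  obtain ⟨x, hx⟩ := hev.exists_hasEigenvector
  exact ⟨x, hx.2, hx.apply_eq_smul⟩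

/-- The eigenprojection of a nonzero positive compact operator for its norm is a limit of
polynomials in that operator. -/
theorem IsCompactOperator.exists_projection_mem {M : NonUnitalStarSubalgebra ℂ (H →L[ℂ] H)}
    (hM : IsClosed (M : Set (H →L[ℂ] H))) {T : H →L[ℂ] H} (hTM : T ∈ M)
    (hT : IsCompactOperator T) (h0 : 0 ≤ T) (hne : T ≠ 0) :
    ∃ P ∈ M, IsStarProjection P ∧ P ≠ 0 ∧ T * P = (‖T‖ : ℂ) • P := by
  wlog h1 : ‖T‖ = 1 generalizing T
  · have hn : (‖T‖ : ℂ) ≠ 0 := by simpa using hne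
    have hTs : ‖(‖T‖ : ℂ)⁻¹ • T‖ = 1 := by
      rw [norm_smul, norm_inv, Complex.norm_real, norm_norm]
      exact inv_mul_cancel₀ (norm_ne_zero_iff.mpr hne)
    have h0' : 0 ≤ (‖T‖ : ℂ)⁻¹ • T := by
      have : (0 : H →L[ℂ] H) ≤ (‖T‖⁻¹ : ℝ) • T := smul_nonneg (by positivity) h0
      have e : (‖T‖ : ℂ)⁻¹ • T = (‖T‖⁻¹ : ℝ) • T := by
        rw [← Complex.ofReal_inv, Complex.coe_smul]
      rwa [e]
    obtain ⟨P, hPM, hP, hP0, hTP⟩ := this (SMulMemClass.smul_mem (‖T‖ : ℂ)⁻¹ hTM) (hT.smul _) h0'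
      (smul_ne_zero (inv_ne_zero hn) hne) hTs
    refine ⟨P, hPM, hP, hP0, ?_⟩
    rw [hTs, smul_mul_assoc] at hTP
    rw [← smul_inv_smul₀ hn (T * P), hTP]
    simp
  let E : Submodule ℂ H := LinearMap.ker (T - 1).toLinearMap
  have hE : ∀ x, x ∈ E ↔ T x = x := fun x => by
    simp [E, sub_eq_zero]
  have hEc : IsClosed (E : Set H) := (T - 1).isClosed_ker
  have : CompleteSpace E := hEc.completeSpace_coe
  let P := E.starProjection
  have hPid : ∀ x ∈ E, P x = x := fun x hx => Submodule.starProjection_eq_self_iff.mpr hx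
  have hP : IsStarProjection P := isStarProjection_starProjection
  have hTP : T * P = P := by
    ext x
    exact (hE _).mp (E.starProjection_apply_mem x)
  have hPT : P * T = P := by
    have := congrArg star hTP
    rwa [star_mul, hP.isSelfAdjoint.star_eq, (IsSelfAdjoint.of_nonneg h0).star_eq] at this
  have hPP : P * P = P := hP.isIdempotentElem
  have hP0 : P ≠ 0 := by
    obtain ⟨x, hx, hTx⟩ := hT.exists_eigenvector_norm h0 hne
    intro h
    apply hx
    rw [h1] at hTx
    rw [← hPid x ((hE x).mpr (by simpa using hTx)), h]
    simp
  -- `T = P + R` with `PR = RP = 0`, and `‖R‖ < 1`: an eigenvector of `R` for `1` would be fixed by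
  -- `T` yet killed by `P`. Hence `T ^ (n + 1) = P + R ^ (n + 1)` tends to `P`; the exponent starts
  -- at `1` because `M` need not contain the identity.
  let R := T - P
  have hRc : IsCompactOperator R := by
    have : R = T * (1 - P) := by rw [mul_sub, hTP, mul_one]
    rw [this]
    exact hT.comp_clm (1 - P)
  have hR0 : 0 ≤ R := by
    have : R = star (1 - P) * T * (1 - P) := by
      rw [star_sub, star_one, hP.isSelfAdjoint.star_eq, sub_mul, one_mul, hPT, mul_sub, mul_one,
        sub_mul, hTP, hPP, sub_self, sub_zero]
    rw [this]
    exact star_left_conjugate_nonneg h0 _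
  have hPR : P * R = 0 := by rw [mul_sub, hPT, hPP, sub_self]
  have hRP : R * P = 0 := by rw [sub_mul, hTP, hPP, sub_self]
  have hRlt : ‖R‖ < 1 := by
    have hle : ‖R‖ ≤ 1 := by
      rw [← h1]
      exact CStarAlgebra.norm_le_norm_of_nonneg_of_le hR0 (sub_le_self _ hP.nonneg)
    refine lt_of_le_of_ne hle fun h => ?_
    have hR : R ≠ 0 := fun h' => by rw [h', norm_zero] at h; exact zero_ne_one h
    obtain ⟨x, hx, hRx⟩ := hRc.exists_eigenvector_norm hR0 hR
    rw [h, Complex.ofReal_one, one_smul] at hRx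
    have hPx : P x = 0 := by
      rw [← hRx]
      exact congrArg (fun S : H →L[ℂ] H => S x) hPR
    have hTx : T x = x := by
      have : T x = R x + P x := by simp [R]
      rw [this, hRx, hPx, add_zero]
    exact hx (by rw [← hPid x ((hE x).mpr hTx), hPx])
  have hpow : ∀ n : ℕ, T ^ (n + 1) = P + R ^ (n + 1) := by
    intro n
    induction n with
    | zero => simp [R]
    | succ n ih =>
      rw [pow_succ, ih, pow_succ R (n + 1), show T = P + R by simp [R], mul_add, add_mul, add_mul,
        hPP, hPR, pow_succ R n, mul_assoc _ R P, hRP]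
      simp
  have hlim : Tendsto (fun n : ℕ => T ^ (n + 1)) atTop (𝓝 P) := by
    simp_rw [hpow]
    have : Tendsto (fun n : ℕ => R ^ (n + 1)) atTop (𝓝 0) :=
      (tendsto_pow_atTop_nhds_zero_of_norm_lt_one hRlt).comp (tendsto_add_atTop_nat 1)
    simpa using this.const_add P
  refine ⟨P, hM.mem_of_tendsto hlim (Eventually.of_forall fun n => ?_), hP, hP0, by
    rw [h1, hTP]; simp⟩
  induction n with
  | zero => simpa using hTM
  | succ n ih => rw [pow_succ]; exact M.mul_mem ih hTM

theorem IsStarProjection.apply_eq_self {P : H →L[ℂ] H} (hP : IsStarProjection P) {x : H}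
    (hx : x ∈ LinearMap.range P.toLinearMap) : P x = x := by
  obtain ⟨y, rfl⟩ := hx
  exact congrArg (fun S : H →L[ℂ] H => S y) hP.isIdempotentElem

theorem IsStarProjection.finiteDimensional_range {P : H →L[ℂ] H} (hP : IsStarProjection P)
    (hc : IsCompactOperator P) : FiniteDimensional ℂ (LinearMap.range P.toLinearMap) := by
  have hcl : IsClosed (LinearMap.range P.toLinearMap : Set H) := by
    have : (LinearMap.range P.toLinearMap : Set H) = {x | P x = x} := by
      ext x
      exact ⟨fun hx => hP.apply_eq_self hx, fun hx => ⟨x, hx⟩⟩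
    rw [this]
    exact isClosed_eq P.continuous continuous_id
  have h := hc.restrict (V := LinearMap.range P.toLinearMap) (f := P.toLinearMap)
    (fun x _ => ⟨x, rfl⟩) hcl
  refine FiniteDimensional.of_isCompactOperator_id (𝕜 := ℂ) ?_
  have e : ⇑(P.toLinearMap.restrict (p := LinearMap.range P.toLinearMap)
      (q := LinearMap.range P.toLinearMap) fun x _ => ⟨x, rfl⟩) = id :=
    funext fun x => Subtype.ext (hP.apply_eq_self x.2)
  exact e ▸ h

/-- An irreducible closed `*`-algebra of compact operators contains a projection of rank one. -/
theorem exists_rankOne_mem_of_irreducible {M : NonUnitalStarSubalgebra ℂ (H →L[ℂ] H)}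
    (hM : IsClosed (M : Set (H →L[ℂ] H))) (hc : ∀ T ∈ M, IsCompactOperator T)
    (hne : ∃ T ∈ M, T ≠ 0)
    (hirr : ∀ K : Submodule ℂ H, IsClosed (K : Set H) → (∀ T ∈ M, ∀ x ∈ K, T x ∈ K) →
      K = ⊥ ∨ K = ⊤) :
    ∃ ξ : H, ‖ξ‖ = 1 ∧ rankOne ℂ ξ ξ ∈ M ∧ Dense {y | ∃ T ∈ M, T ξ = y} := by
  -- A nonzero projection in `M` of least rank will turn out to have rank one.
  have hex : ∃ n : ℕ, ∃ P ∈ M, IsStarProjection P ∧ P ≠ 0 ∧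
      Module.finrank ℂ (LinearMap.range P.toLinearMap) = n := by
    obtain ⟨T, hT, hT0⟩ := hne
    have hT2 : star T * T ∈ M := mul_mem (star_mem hT) hT
    obtain ⟨P, hPM, hP, hP0, -⟩ := IsCompactOperator.exists_projection_mem hM hT2 (hc _ hT2)
      (star_mul_self_nonneg T) (by simpa using hT0)
    exact ⟨_, P, hPM, hP, hP0, rfl⟩
  classical
  obtain ⟨P, hPM, hP, hP0, hn⟩ := Nat.find_spec hex
  have hmin := fun m => Nat.find_min hex (m := m)
  rw [← hn] at hmin
  clear hn
  have := hP.finiteDimensional_range (hc P hPM)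
  have hPP : P * P = P := hP.isIdempotentElem
  -- compressions of self-adjoint elements by the minimal projection `P` are scalar
  have hscal : ∀ b ∈ M, IsSelfAdjoint b → ∃ r : ℝ, P * b * P = (r : ℂ) • P := by
    intro b hb hbsa
    let B := P * b * P
    have hBM : B ∈ M := M.mul_mem (M.mul_mem hPM hb) hPM
    have hBsa : IsSelfAdjoint B := by
      simp only [B, isSelfAdjoint_iff, star_mul, hbsa.star_eq, hP.isSelfAdjoint.star_eq, mul_assoc]
    -- Adding `‖B‖ P` makes the compression positive. If `C ≠ 0`, its top eigenprojection `Q` lies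
    -- under `P`, so by minimality has the same range, and `C` is a multiple of `P`.
    let C := B + (‖B‖ : ℂ) • P
    have hCM : C ∈ M := M.add_mem hBM (SMulMemClass.smul_mem _ hPM)
    have hBP : B * P = B := by simp only [B, mul_assoc, hPP]
    have hPB : P * B = B := by simp only [B, ← mul_assoc, hPP]
    have hPC : P * C = C := by rw [mul_add, hPB, mul_smul_comm, hPP]
    have hC0 : 0 ≤ C := by
      have h1 : 0 ≤ B + algebraMap ℝ (H →L[ℂ] H) ‖B‖ := by
        have := hBsa.neg_algebraMap_norm_le_self
        rwa [neg_le_iff_add_nonneg] at this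
      have h2 : C = star P * (B + algebraMap ℝ (H →L[ℂ] H) ‖B‖) * P := by
        rw [hP.isSelfAdjoint.star_eq, mul_add, add_mul, hPB, hBP, Algebra.algebraMap_eq_smul_one,
          mul_smul_comm, smul_mul_assoc, mul_one, hPP, ← Complex.coe_smul]
      rw [h2]
      exact star_left_conjugate_nonneg h1 _
    by_cases hC : C = 0
    · refine ⟨-‖B‖, ?_⟩
      change B = _
      rw [Complex.ofReal_neg, neg_smul]
      exact eq_neg_of_add_eq_zero_left hC
    obtain ⟨Q, hQM, hQ, hQ0, hCQ⟩ := IsCompactOperator.exists_projection_mem hM hCM (hc _ hCM) hC0 hC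
    have hCn : (‖C‖ : ℂ) ≠ 0 := by simpa using hC
    have hPQ : P * Q = Q := by
      have : Q = (‖C‖ : ℂ)⁻¹ • (C * Q) := by rw [hCQ, inv_smul_smul₀ hCn]
      rw [this, mul_smul_comm, ← mul_assoc, hPC]
    have hrange : LinearMap.range Q.toLinearMap ≤ LinearMap.range P.toLinearMap := by
      rintro _ ⟨x, rfl⟩
      exact ⟨Q x, congrArg (fun S : H →L[ℂ] H => S x) hPQ⟩
    have heq : LinearMap.range Q.toLinearMap = LinearMap.range P.toLinearMap := by
      refine Submodule.eq_of_le_of_finrank_le hrange ?_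
      by_contra! hlt
      exact hmin _ hlt ⟨Q, hQM, hQ, hQ0, rfl⟩
    have hQP : Q * P = P := by
      ext x
      refine hQ.apply_eq_self ?_
      rw [heq]
      exact ⟨x, rfl⟩
    have hCP : C = (‖C‖ : ℂ) • P := by
      have h3 : C * P = C := by rw [add_mul, hBP, smul_mul_assoc, hPP]
      calc C = C * P := h3.symm
        _ = C * (Q * P) := by rw [hQP]
        _ = (‖C‖ : ℂ) • P := by rw [← mul_assoc, hCQ, smul_mul_assoc, hQP]
    refine ⟨‖C‖ - ‖B‖, ?_⟩
    rw [Complex.ofReal_sub, sub_smul, ← hCP]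
    simp [C, B]
  obtain ⟨x₀, hx₀⟩ : ∃ x, P x ≠ 0 := by
    by_contra! h
    exact hP0 (by ext x; simp [h x])
  let ξ := ((‖P x₀‖ : ℂ)⁻¹) • P x₀
  have hξ1 : ‖ξ‖ = 1 := by
    simp only [ξ, norm_smul, norm_inv, Complex.norm_real, norm_norm]
    exact inv_mul_cancel₀ (norm_ne_zero_iff.mpr hx₀)
  have hPξ : P ξ = ξ := hP.apply_eq_self ⟨(‖P x₀‖ : ℂ)⁻¹ • x₀, by simp [ξ]⟩
  have hPsa : ∀ x y, inner ℂ (P x) y = inner ℂ x (P y) := fun x y => by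
    have h := hP.isSelfAdjoint.star_eq
    rw [ContinuousLinearMap.star_eq_adjoint] at h
    nth_rw 1 [← h]
    rw [ContinuousLinearMap.adjoint_inner_left]
  -- Since `PbP` is scalar on the range of `P`, a vector of that range orthogonal to `ξ` is
  -- orthogonal to `Mξ`. As `Mξ` is dense, the range is spanned by `ξ`.
  have horth_sa : ∀ y, P y = y → inner ℂ y ξ = 0 → ∀ b ∈ M, IsSelfAdjoint b →
      inner ℂ y (b ξ) = 0 := by
    intro y hy hyξ b hb hbsa
    obtain ⟨r, hr⟩ := hscal b hb hbsa
    have h1 : P (b (P ξ)) = (r : ℂ) • P ξ := congrArg (fun S : H →L[ℂ] H => S ξ) hr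
    rw [hPξ] at h1
    rw [← hy, hPsa, h1, inner_smul_right, hyξ, mul_zero]
  have horth : ∀ y, P y = y → inner ℂ y ξ = 0 → ∀ b ∈ M, inner ℂ y (b ξ) = 0 := by
    intro y hy hyξ b hb
    have hs := star_mem hb
    have e : b = (2⁻¹ : ℂ) • (b + star b) + (2⁻¹ * Complex.I : ℂ) • (Complex.I • (star b - b)) := by
      rw [smul_smul, mul_assoc, Complex.I_mul_I]
      module
    have h1 := horth_sa y hy hyξ (b + star b) (M.add_mem hb hs) (by
      rw [isSelfAdjoint_iff, star_add, star_star, add_comm])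
    have h2 := horth_sa y hy hyξ (Complex.I • (star b - b)) (SMulMemClass.smul_mem _ (sub_mem hs hb)) (by
      rw [isSelfAdjoint_iff, star_smul, star_sub, star_star, Complex.star_def, Complex.conj_I,
        neg_smul, ← smul_neg, neg_sub])
    rw [e, _root_.add_apply, _root_.smul_apply, _root_.smul_apply, inner_add_right,
      inner_smul_right, inner_smul_right, h1, h2]
    simp
  have hdense : Dense {y | ∃ T ∈ M, T ξ = y} := by
    let L₀ : Submodule ℂ H := M.toNonUnitalSubalgebra.toSubmodule.map
      (ContinuousLinearMap.apply ℂ H ξ).toLinearMap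
    have hL₀ : (L₀ : Set H) = {y | ∃ T ∈ M, T ξ = y} := rfl
    rw [← hL₀]
    have hinv : ∀ T ∈ M, ∀ x ∈ L₀, T x ∈ L₀ := by
      rintro T hT _ ⟨S, hS, rfl⟩
      exact ⟨T * S, M.mul_mem hT hS, rfl⟩
    have h := (hirr L₀.topologicalClosure L₀.isClosed_topologicalClosure fun T hT x hx =>
      map_mem_closure T.continuous hx (hinv T hT)).resolve_left fun h => by
        have : ξ ∈ L₀.topologicalClosure := L₀.le_topologicalClosure ⟨P, hPM, hPξ⟩
        rw [h] at this
        have h0 : ξ = 0 := this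
        rw [h0] at hξ1
        simp at hξ1
    intro x
    have : x ∈ L₀.topologicalClosure := by rw [h]; trivial
    exact this
  have hrank : P = rankOne ℂ ξ ξ := by
    ext x
    rw [rankOne_apply, ← sub_eq_zero]
    have hfix : P (P x - (inner ℂ ξ x : ℂ) • ξ) = P x - (inner ℂ ξ x : ℂ) • ξ := by
      rw [map_sub, map_smul, hPξ]
      congr 1
      exact congrArg (fun S : H →L[ℂ] H => S x) hPP
    have h0 : inner ℂ (P x - (inner ℂ ξ x : ℂ) • ξ) ξ = 0 := by
      rw [inner_sub_left, inner_smul_left, hPsa, hPξ, inner_self_eq_norm_sq_to_K, hξ1,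
        inner_conj_symm]
      simp
    refine hdense.eq_zero_of_inner_left ℂ ?_
    rintro _ ⟨T, hT, rfl⟩
    exact horth _ hfix h0 T hT
  exact ⟨ξ, hξ1, hrank ▸ hPM, hdense⟩

/-- An irreducible `*`-algebra of compact operators is dense in the compact operators. -/
theorem rankOne_mem_topologicalClosure_of_irreducible (M : NonUnitalStarSubalgebra ℂ (H →L[ℂ] H))
    (hc : ∀ T ∈ M, IsCompactOperator T) (hne : ∃ T ∈ M, T ≠ 0)
    (hirr : ∀ K : Submodule ℂ H, IsClosed (K : Set H) → (∀ T ∈ M, ∀ x ∈ K, T x ∈ K) →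
      K = ⊥ ∨ K = ⊤) (x y : H) : rankOne ℂ x y ∈ M.topologicalClosure := by
  have hle := M.le_topologicalClosure
  have hcl : IsClosed (M.topologicalClosure : Set (H →L[ℂ] H)) := M.isClosed_topologicalClosure
  obtain ⟨ξ, hξ, hmem, hdense⟩ := exists_rankOne_mem_of_irreducible hcl
    (fun T hT => isClosed_setOfPred_isCompactOperator.closure_subset_iff.mpr hc hT)
    (hne.imp fun T hT => ⟨hle hT.1, hT.2⟩)
    (fun K hK h => hirr K hK fun T hT => h T (hle hT))
  have hmem2 : ∀ p ∈ {y | ∃ T ∈ M.topologicalClosure, T ξ = y} ×ˢ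
      {y | ∃ T ∈ M.topologicalClosure, T ξ = y},
      rankOne ℂ p.1 p.2 ∈ (M.topologicalClosure : Set (H →L[ℂ] H)) := by
    rintro ⟨_, _⟩ ⟨⟨S, hS, rfl⟩, ⟨T, hT, rfl⟩⟩
    have : rankOne ℂ (S ξ) (T ξ) = S * rankOne ℂ ξ ξ * star T := by
      ext z
      simp [ContinuousLinearMap.star_eq_adjoint, ContinuousLinearMap.adjoint_inner_right]
    rw [this]
    exact mul_mem (mul_mem hS hmem) (star_mem hT)
  have hcont : Continuous fun p : H × H => (rankOne ℂ p.1 p.2 : H →L[ℂ] H) :=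
    by simp only [rankOne_def]; fun_prop
  have h := map_mem_closure hcont ((hdense.prod hdense) (x, y)) hmem2
  rwa [hcl.closure_eq] at h

end CompactOperators

/-! ### Gram operators and norms of finite rank operators -/

section Gram

variable {n : ℕ} {H : Type v} [NormedAddCommGroup H] [InnerProductSpace ℂ H]

/-- The Gram operator of a finite family of vectors. -/
noncomputable def gramOperator (x : Fin n → H) :
    EuclideanSpace ℂ (Fin n) →L[ℂ] EuclideanSpace ℂ (Fin n) :=
  ∑ i, ∑ j, inner ℂ (x i) (x j) •
    rankOne ℂ (EuclideanSpace.single i (1 : ℂ)) (EuclideanSpace.single j (1 : ℂ))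

/-- The synthesis operator `α ↦ ∑ i, α i • x i` of a finite family of vectors. -/
noncomputable def synthesisOperator (x : Fin n → H) : EuclideanSpace ℂ (Fin n) →L[ℂ] H :=
  ∑ i, rankOne ℂ (x i) (EuclideanSpace.single i (1 : ℂ))

variable [CompleteSpace H]

theorem adjoint_synthesisOperator (x : Fin n → H) :
    (synthesisOperator x).adjoint = ∑ i, rankOne ℂ (EuclideanSpace.single i (1 : ℂ)) (x i) := by
  simp [synthesisOperator, map_sum]

theorem adjoint_synthesisOperator_comp_self (x : Fin n → H) :
    (synthesisOperator x).adjoint ∘L synthesisOperator x = gramOperator x := by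
  rw [adjoint_synthesisOperator]
  ext α
  simp [synthesisOperator, gramOperator, Finset.sum_apply, mul_comm]
  simp only [Finset.sum_mul]
  rw [Finset.sum_comm]
  refine Finset.sum_congr rfl fun i _ => Finset.sum_congr rfl fun j _ => ?_
  ring

theorem synthesisOperator_comp_adjoint (x y : Fin n → H) :
    synthesisOperator x ∘L (synthesisOperator y).adjoint = ∑ i, rankOne ℂ (x i) (y i) := by
  rw [adjoint_synthesisOperator]
  have hX : ∀ j, synthesisOperator x (EuclideanSpace.single j (1 : ℂ)) = x j := fun j => by
    simp [synthesisOperator, EuclideanSpace.inner_single_left]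
  ext α
  simp [hX]

theorem gramOperator_nonneg (x : Fin n → H) : 0 ≤ gramOperator x := by
  rw [← adjoint_synthesisOperator_comp_self, ContinuousLinearMap.nonneg_iff_isPositive]
  exact ContinuousLinearMap.isPositive_adjoint_comp_self _

/-- With synthesis operators `X`, `Y` the sum is `XY*`. It has the norm of `sY*` for `s = √(X*X)`,
because `s² = X*X`. The resulting formula involves inner products only and lives on one fixed
finite-dimensional space, so it can be followed continuously as `H` varies. -/
theorem norm_sum_rankOne_sq (x y : Fin n → H) :
    ‖∑ i, rankOne ℂ (x i) (y i)‖ ^ 2 =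
      ‖CFC.sqrt (gramOperator x) * gramOperator y * CFC.sqrt (gramOperator x)‖ := by
  let X := synthesisOperator x
  let Y := synthesisOperator y
  let s := CFC.sqrt (gramOperator x)
  have hs : s.adjoint = s := by
    rw [← ContinuousLinearMap.star_eq_adjoint]
    exact (IsSelfAdjoint.of_nonneg (CFC.sqrt_nonneg _)).star_eq
  have hss : s ∘L s = X.adjoint ∘L X := by
    rw [adjoint_synthesisOperator_comp_self]
    exact CFC.sqrt_mul_sqrt_self _ (gramOperator_nonneg x)
  have hR : (X ∘L Y.adjoint).adjoint ∘L (X ∘L Y.adjoint) =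
      (s ∘L Y.adjoint).adjoint ∘L (s ∘L Y.adjoint) := by
    simp only [ContinuousLinearMap.adjoint_comp, ContinuousLinearMap.adjoint_adjoint, hs]
    calc Y ∘L X.adjoint ∘L X ∘L Y.adjoint = Y ∘L (X.adjoint ∘L X) ∘L Y.adjoint := rfl
      _ = Y ∘L (s ∘L s) ∘L Y.adjoint := by rw [hss]
      _ = _ := rfl
  rw [← synthesisOperator_comp_adjoint, sq, ← ContinuousLinearMap.norm_adjoint_comp_self, hR,
    ContinuousLinearMap.norm_adjoint_comp_self, ← LinearIsometryEquiv.norm_map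
      ContinuousLinearMap.adjoint (s ∘L Y.adjoint), ← ContinuousLinearMap.norm_adjoint_comp_self,
    ContinuousLinearMap.adjoint_adjoint]
  congr 1
  rw [ContinuousLinearMap.adjoint_comp, ContinuousLinearMap.adjoint_adjoint, hs,
    ← adjoint_synthesisOperator_comp_self y]
  rfl

end Gram

/-! ### Continuity of norms and comparison of fibres in a continuous field -/

namespace ContinuousHilbertField

variable {T : Type w} [TopologicalSpace T] {H : T → Type v}
  [∀ t, NormedAddCommGroup (H t)] [∀ t, InnerProductSpace ℂ (H t)]
  (E : ContinuousHilbertField H)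

theorem exists_eq_sum_of_mem_finiteRankSections {a : ∀ t, H t →L[ℂ] H t}
    (ha : a ∈ E.finiteRankSections) :
    ∃ (n : ℕ) (x y : Fin n → ∀ t, H t), (∀ i, x i ∈ E.sections) ∧ (∀ i, y i ∈ E.sections) ∧
      ∀ t, a t = ∑ i, rankOne ℂ (x i t) (y i t) := by
  obtain ⟨n, c, g, rfl⟩ := Submodule.mem_span_set'.mp ha
  have hg := fun i => (g i).2
  choose x hx y hy hxy using hg
  refine ⟨n, fun i => c i • x i, y, fun i => E.sections.smul_mem _ (hx i), hy, fun t => ?_⟩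
  simp [Finset.sum_apply, hxy]

theorem IsContinuousOperatorSection.apply_mem_sections {E : ContinuousHilbertField H}
    {a : ∀ t, H t →L[ℂ] H t} (ha : E.IsContinuousOperatorSection a) {x : ∀ t, H t}
    (hx : x ∈ E.sections) : (fun t => a t (x t)) ∈ E.sections := by
  have hfin : ∀ b ∈ E.finiteRankSections, (fun t => b t (x t)) ∈ E.sections := by
    intro b hb
    induction hb using Submodule.span_induction with
    | zero => exact E.sections.zero_mem
    | add p q _ _ hp hq => exact E.sections.add_mem hp hq
    | smul c p _ hp => exact E.sections.smul_mem c hp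
    | mem p hp =>
      obtain ⟨y, hy, z, hz, rfl⟩ := hp
      simpa using E.smul_mem (E.continuous_inner hz hx) hy
  refine E.mem_of_locallyApproximable _ fun t ε hε => ?_
  obtain ⟨b, hb, h⟩ := ha.2 t (ε / (‖x t‖ + 1)) (by positivity)
  refine ⟨_, hfin b hb, ?_⟩
  filter_upwards [h, ((E.continuous_norm x hx).tendsto t).eventually
    (Iio_mem_nhds (lt_add_one _))] with s hs hs'
  have hs' : ‖x s‖ < ‖x t‖ + 1 := hs'
  calc ‖a s (x s) - b s (x s)‖ = ‖(a s - b s) (x s)‖ := by simp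
    _ ≤ ‖a s - b s‖ * ‖x s‖ := (a s - b s).le_opNorm _
    _ ≤ ε / (‖x t‖ + 1) * (‖x t‖ + 1) := by gcongr
    _ = ε := by field_simp

variable [∀ t, CompleteSpace (H t)]

theorem continuous_norm_of_mem_finiteRankSections {a : ∀ t, H t →L[ℂ] H t}
    (ha : a ∈ E.finiteRankSections) : Continuous fun t => ‖a t‖ := by
  obtain ⟨n, x, y, hx, hy, h⟩ := E.exists_eq_sum_of_mem_finiteRankSections ha
  have hG : ∀ z : Fin n → ∀ t, H t, (∀ i, z i ∈ E.sections) →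
      Continuous fun t => gramOperator fun i => z i t := by
    intro z hz
    unfold gramOperator
    exact continuous_finsetSum _ fun i _ => continuous_finsetSum _ fun j _ =>
      (E.continuous_inner (hz i) (hz j)).smul continuous_const
  have hs : Continuous fun t => CFC.sqrt (gramOperator fun i => x i t) :=
    CFC.continuousOn_sqrt.comp_continuous (hG x hx) fun t => gramOperator_nonneg _
  have key : ∀ t, ‖a t‖ = √ ‖CFC.sqrt (gramOperator fun i => x i t) *
      (gramOperator fun i => y i t) * CFC.sqrt (gramOperator fun i => x i t)‖ := by
    intro t
    rw [← norm_sum_rankOne_sq, ← h, Real.sqrt_sq (norm_nonneg _)]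
  simp_rw [key]
  exact ((hs.mul (hG y hy)).mul hs).norm.sqrt

theorem IsContinuousOperatorSection.continuous_norm {E : ContinuousHilbertField H}
    {a : ∀ t, H t →L[ℂ] H t} (ha : E.IsContinuousOperatorSection a) :
    Continuous fun t => ‖a t‖ := by
  rw [continuous_iff_continuousAt]
  intro t
  rw [ContinuousAt, Metric.tendsto_nhds]
  intro ε hε
  obtain ⟨b, hb, h⟩ := ha.2 t (ε / 4) (by positivity)
  have hbc := (E.continuous_norm_of_mem_finiteRankSections hb).tendsto t
  rw [Metric.tendsto_nhds] at hbc
  filter_upwards [h, hbc (ε / 4) (by positivity)] with s hs hs'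
  have h0 := h.self_of_nhds
  have h1 := abs_norm_sub_norm_le (a s) (b s)
  have h2 := abs_norm_sub_norm_le (a t) (b t)
  rw [Real.dist_eq] at hs' ⊢
  rw [abs_le] at h1 h2
  rw [abs_lt] at hs' ⊢
  constructor <;> linarith [h1.1, h1.2, h2.1, h2.2, hs'.1, hs'.2]

/-- The fibres of a continuous field of Hilbert spaces over topologically indistinguishable points
are canonically isometric. -/
theorem exists_linearIsometryEquiv_of_inseparable {s t : T} (hst : Inseparable s t) :
    ∃ U : H s ≃ₗᵢ[ℂ] H t, ∀ x ∈ E.sections, U (x s) = x t := by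
  let e : ∀ r, E.sections →ₗ[ℂ] H r := fun r => (LinearMap.proj r).comp E.sections.subtype
  have hd : ∀ r, DenseRange (e r) := fun r => by
    refine (E.dense_fiber r).mono ?_
    rintro _ ⟨x, hx, rfl⟩
    exact ⟨⟨x, hx⟩, rfl⟩
  have hn : ∀ x, ‖e t x‖ = ‖e s x‖ := fun x =>
    ((hst.map (E.continuous_norm _ x.2)).eq).symm
  refine ⟨LinearEquiv.extendOfIsometry (LinearEquiv.refl ℂ E.sections) (e s) (e t) (hd s) (hd t) hn,
    fun x hx => ?_⟩
  exact LinearEquiv.extendOfIsometry_eq (LinearEquiv.refl ℂ E.sections) (e s) (e t) (hd s) (hd t) hn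
    ⟨x, hx⟩

end ContinuousHilbertField

/-! ### Approximate units and ideals of elements vanishing on a set -/

section ApproximateUnit

variable {S : Type u} [NonUnitalCStarAlgebra S]

theorem NonUnitalStarSubalgebra.exists_norm_sub_mul_le (I : NonUnitalStarSubalgebra ℂ S)
    (hI : IsClosed (I : Set S)) (s : Finset S) (hs : ∀ d ∈ s, d ∈ I) {ε : ℝ} (hε : 0 < ε) :
    ∃ e ∈ I, ‖e‖ ≤ 1 ∧ ∀ d ∈ s, ‖d - e * d‖ ≤ ε := by
  have : IsClosed (I : Set S) := hI
  let _ : PartialOrder I := CStarAlgebra.spectralOrder I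
  let _ : StarOrderedRing I := CStarAlgebra.spectralOrderedRing I
  have hu := CStarAlgebra.increasingApproximateUnit I
  have hne := hu.neBot
  have h : ∀ d ∈ s, ∀ᶠ e : I in CStarAlgebra.approximateUnit I, ‖d - e * d‖ ≤ ε := by
    intro d hd
    have ht := hu.tendsto_mul_right ⟨d, hs d hd⟩
    filter_upwards [ht.eventually (Metric.closedBall_mem_nhds _ hε)] with e he
    rw [dist_comm, dist_eq_norm] at he
    exact he
  obtain ⟨e, he, he1⟩ := (((Filter.eventually_all_finset s).mpr h).and hu.eventually_norm).exists
  exact ⟨e, e.2, he1, he⟩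

end ApproximateUnit

section VanishingIdeal

variable {S : Type u} [NonUnitalCStarAlgebra S] {T : Type w} {H : T → Type v}
  [∀ t, NormedAddCommGroup (H t)] [∀ t, InnerProductSpace ℂ (H t)] [∀ t, CompleteSpace (H t)]

/-- The ideal of elements vanishing on a set of points in a family of representations. -/
def vanishingIdeal (π : ∀ t, S →⋆ₙₐ[ℂ] (H t →L[ℂ] H t)) (F : Set T) :
    NonUnitalStarSubalgebra ℂ S where
  carrier := {a | ∀ t ∈ F, π t a = 0}
  add_mem' ha hb t ht := by rw [map_add, ha t ht, hb t ht, add_zero]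
  zero_mem' t _ := map_zero _
  mul_mem' ha _ t ht := by rw [map_mul, ha t ht, zero_mul]
  smul_mem' c a ha t ht := by rw [map_smul, ha t ht, smul_zero]
  star_mem' ha t ht := by rw [map_star, ha t ht, star_zero]

variable {π : ∀ t, S →⋆ₙₐ[ℂ] (H t →L[ℂ] H t)} {F : Set T}

theorem mem_vanishingIdeal {a : S} : a ∈ vanishingIdeal π F ↔ ∀ t ∈ F, π t a = 0 := Iff.rfl

theorem isClosed_vanishingIdeal : IsClosed (vanishingIdeal π F : Set S) := by
  have : (vanishingIdeal π F : Set S) = ⋂ t ∈ F, {a | π t a = 0} := by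
    ext a
    simp [mem_vanishingIdeal]
  rw [this]
  exact isClosed_biInter fun t _ => isClosed_eq (π t).continuous_of_cstar continuous_const

end VanishingIdeal

/-- Layer-cake identity: each summand ramps from `0` to `1` on one unit band of levels. It splits `n
f` into layers in the Dauns–Hofmann argument. -/
theorem sum_range_max_min_sub (n : ℕ) (x : ℝ) :
    ∑ k ∈ Finset.range n, max 0 (min 1 (x - k)) = max 0 (min (n : ℝ) x) := by
  induction n with
  | zero =>
    rw [Finset.sum_range_zero, Nat.cast_zero, max_eq_left (min_le_left _ _)]
  | succ n ih =>
    rw [Finset.sum_range_succ, ih, Nat.cast_succ]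
    have hn : (0 : ℝ) ≤ n := n.cast_nonneg
    rcases le_total x n with h | h
    · rw [min_eq_right h, min_eq_right (by linarith : x ≤ n + 1),
        max_eq_left ((min_le_right _ _).trans (by linarith : x - n ≤ 0)), add_zero]
    · rw [min_eq_left h, max_eq_right hn, max_eq_right (le_min zero_le_one (by linarith)),
        max_eq_right (le_min (by linarith) (by linarith))]
      rcases le_total x (n + 1) with h' | h'
      · rw [min_eq_right h', min_eq_right (by linarith)]
        ring
      · rw [min_eq_left h', min_eq_left (by linarith)]

/-! ### Urysohn, Dauns–Hofmann and Stone–Weierstrass for fields of compact operators -/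

namespace ContinuousHilbertField

variable {T : Type w} [TopologicalSpace T] {H : T → Type v}
  [∀ t, NormedAddCommGroup (H t)] [∀ t, InnerProductSpace ℂ (H t)]
  {E : ContinuousHilbertField H}

theorem IsContinuousOperatorSection.apply_mem_of_rankOne_mem {a : ∀ t, H t →L[ℂ] H t}
    (ha : E.IsContinuousOperatorSection a) {t : T} {M : Submodule ℂ (H t →L[ℂ] H t)}
    (hM : IsClosed (M : Set (H t →L[ℂ] H t))) (h : ∀ x y, rankOne ℂ x y ∈ M) : a t ∈ M := by
  have hfin : ∀ b ∈ E.finiteRankSections, b t ∈ M := by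
    intro b hb
    induction hb using Submodule.span_induction with
    | zero => exact M.zero_mem
    | add p q _ _ hp hq => exact M.add_mem hp hq
    | smul c p _ hp => exact M.smul_mem c hp
    | mem p hp =>
      obtain ⟨y, hy, z, hz, rfl⟩ := hp
      exact h _ _
  have : a t ∈ closure (M : Set (H t →L[ℂ] H t)) := by
    rw [Metric.mem_closure_iff]
    intro ε hε
    obtain ⟨b, hb, h⟩ := ha.2 t (ε / 2) (half_pos hε)
    refine ⟨b t, hfin b hb, ?_⟩
    rw [dist_eq_norm]
    exact lt_of_le_of_lt h.self_of_nhds (half_lt_self hε)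
  rwa [hM.closure_eq] at this

variable [∀ t, CompleteSpace (H t)]

/-- Closedness comes from continuity of the norm, so no separation axiom on `T` is needed; the lemma
can thus serve to prove local compactness of the spectrum. -/
theorem isCompact_setOf_le_norm {a : ∀ t, H t →L[ℂ] H t} (ha : a ∈ E.sectionAlgebra) {δ : ℝ}
    (hδ : 0 < δ) : IsCompact {t | δ ≤ ‖a t‖} := by
  have h : ∀ᶠ t in cocompact T, ‖a t‖ < δ := ha.2.eventually (Iio_mem_nhds hδ)
  obtain ⟨K, hK, hKs⟩ := mem_cocompact.mp h
  refine hK.of_isClosed_subset (isClosed_le continuous_const ha.1.continuous_norm) fun t ht => ?_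
  by_contra hnot
  have : ‖a t‖ < δ := hKs hnot
  exact absurd ht (not_le.mpr this)

variable {S : Type u} [NonUnitalCStarAlgebra S] {π : ∀ t, S →⋆ₙₐ[ℂ] (H t →L[ℂ] H t)}
  (hπ : ∀ a, (fun t => π t a) ∈ E.sectionAlgebra) (hirr : ∀ t, IsIrreducibleRep (π t))
  (hreg : ∀ U : Set T, IsOpen U → ∀ t ∈ U, ∃ a ∈ vanishingIdeal π Uᶜ, π t a ≠ 0)

include hπ hirr hreg

/-- By `hreg` the ideal of elements vanishing on `F` is not killed at `t`, so its image there is an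
irreducible algebra of compacts, dense in all compacts. -/
theorem exists_mem_vanishingIdeal_norm_sub_lt {a : ∀ t, H t →L[ℂ] H t}
    (ha : E.IsContinuousOperatorSection a) {F : Set T} (hF : IsClosed F) {t : T} (ht : t ∉ F)
    {ε : ℝ} (hε : 0 < ε) : ∃ d ∈ vanishingIdeal π F, ‖a t - π t d‖ < ε := by
  obtain ⟨b, hb, hbt⟩ := hreg Fᶜ hF.isOpen_compl t ht
  rw [compl_compl] at hb
  let M := (vanishingIdeal π F).map (π t)
  have hmem : ∀ d ∈ vanishingIdeal π F, π t d ∈ M := fun d hd => ⟨d, hd, rfl⟩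
  have h1 : ∀ x y, rankOne ℂ x y ∈ M.topologicalClosure := by
    refine rankOne_mem_topologicalClosure_of_irreducible M ?_ ⟨π t b, hmem b hb, hbt⟩ fun K hK h => ?_
    · rintro _ ⟨d, -, rfl⟩
      exact (hπ d).1.1 t
    · refine (hirr t).eq_bot_or_eq_top_of_ideal (J := vanishingIdeal π F) ?_ ?_ ⟨b, hb, hbt⟩ hK
        fun s hs => h _ (hmem s hs)
      · intro c s hs r hr
        rw [map_mul, hs r hr, mul_zero]
      · intro c s hs r hr
        rw [map_mul, hs r hr, zero_mul]
  have h2 : a t ∈ M.topologicalClosure.toSubmodule :=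
    ha.apply_mem_of_rankOne_mem M.isClosed_topologicalClosure h1
  have h3 : a t ∈ closure (M : Set (H t →L[ℂ] H t)) := h2
  obtain ⟨_, ⟨d, hd, rfl⟩, hdist⟩ := Metric.mem_closure_iff.mp h3 ε hε
  exact ⟨d, hd, by rwa [dist_eq_norm] at hdist⟩

/-- A noncommutative Urysohn lemma. -/
theorem exists_mem_vanishingIdeal_norm_sub_mul_le (b : S) {F G : Set T} (hF : IsClosed F)
    (hG : IsClosed G) (hFG : Disjoint F G) {ε : ℝ} (hε : 0 < ε) :
    ∃ e ∈ vanishingIdeal π F, ‖e‖ ≤ 1 ∧ ∀ t ∈ G, ‖π t b - π t (e * b)‖ ≤ ε := by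
  -- Where `π t b` is small any contraction `e` will do. On the remaining compact set finitely many
  -- `d t` in the ideal approximate `b`, and `e` is an approximate unit for these.
  have hV : IsCompact ({t | ε / 4 ≤ ‖π t b‖} ∩ G) :=
    (isCompact_setOf_le_norm (hπ b) (by positivity)).inter_right hG
  have hloc : ∀ t ∈ {t | ε / 4 ≤ ‖π t b‖} ∩ G, ∃ d ∈ vanishingIdeal π F,
      ‖π t b - π t d‖ < ε / 4 := fun t ht =>
    exists_mem_vanishingIdeal_norm_sub_lt hπ hirr hreg (hπ b).1 hF
      (hFG.notMem_of_mem_right ht.2) (by positivity)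
  choose! d hd hbd using hloc
  obtain ⟨s, hs, hcover⟩ := hV.elim_nhds_subcover (fun t => {r | ‖π r (b - d t)‖ < ε / 4})
    fun t ht => by
      refine (hπ (b - d t)).1.continuous_norm.tendsto t (Iio_mem_nhds ?_)
      rw [map_sub]
      exact hbd t ht
  classical
  obtain ⟨e, he, he1, hes⟩ := (vanishingIdeal π F).exists_norm_sub_mul_le isClosed_vanishingIdeal
    (s.image d) (fun c hc => by
      obtain ⟨t, ht, rfl⟩ := Finset.mem_image.mp hc
      exact hd t (hs t ht)) (by positivity : 0 < ε / 4)
  refine ⟨e, he, he1, fun t ht => ?_⟩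
  have het : ‖π t e‖ ≤ 1 := (NonUnitalStarAlgHom.norm_apply_le _ _).trans he1
  rw [← map_sub]
  by_cases htV : ε / 4 ≤ ‖π t b‖
  · obtain ⟨r, hr, htr⟩ := Set.mem_iUnion₂.mp (hcover ⟨htV, ht⟩)
    have htr : ‖π t (b - d r)‖ < ε / 4 := htr
    have h1 : ‖π t (d r - e * d r)‖ ≤ ε / 4 :=
      (NonUnitalStarAlgHom.norm_apply_le _ _).trans (hes _ (Finset.mem_image_of_mem d hr))
    have e1 : b - e * b = (b - d r) + (d r - e * d r) - e * (b - d r) := by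
      rw [mul_sub]; abel
    rw [e1, map_sub, map_add, map_mul]
    calc _ ≤ ‖π t (b - d r)‖ + ‖π t (d r - e * d r)‖ + ‖π t e‖ * ‖π t (b - d r)‖ :=
          (norm_sub_le _ _).trans (add_le_add (norm_add_le _ _) (norm_mul_le _ _))
      _ ≤ ε / 4 + ε / 4 + 1 * (ε / 4) := by gcongr
      _ ≤ ε := by linarith
  · push Not at htV
    rw [map_sub, map_mul]
    calc _ ≤ ‖π t b‖ + ‖π t e‖ * ‖π t b‖ :=
          (norm_sub_le _ _).trans (add_le_add_right (norm_mul_le _ _) _)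
      _ ≤ ε / 4 + 1 * (ε / 4) := by gcongr
      _ ≤ ε := by linarith

/-- Approximate form of the Dauns-Hofmann theorem. -/
theorem exists_norm_smul_sub_le (b : S) {f : T → ℝ} (hf : Continuous f) (hf0 : ∀ t, 0 ≤ f t)
    (hf1 : ∀ t, f t ≤ 1) {ε : ℝ} (hε : 0 < ε) :
    ∃ c : S, ∀ t, ‖(f t : ℂ) • π t b - π t c‖ ≤ ε := by
  obtain ⟨n, hn⟩ := exists_nat_gt (2 * ‖b‖ / (ε / 2))
  have hn0 : (0 : ℝ) < n := lt_of_le_of_lt (by positivity) hn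
  -- `e k` imitates the `k`-th layer of `n f`: zero where `n f ≤ k`, nearly a unit for `b` where `n
  -- f ≥ k + 1`.
  have hstep : ∀ k : ℕ, ∃ e ∈ vanishingIdeal π {t | f t * n ≤ k}, ‖e‖ ≤ 1 ∧
      ∀ t ∈ {t | (k : ℝ) + 1 ≤ f t * n}, ‖π t b - π t (e * b)‖ ≤ ε / 2 := by
    intro k
    refine exists_mem_vanishingIdeal_norm_sub_mul_le hπ hirr hreg b
      (isClosed_le (hf.mul continuous_const) continuous_const)
      (isClosed_le continuous_const (hf.mul continuous_const)) ?_ (by positivity)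
    rw [Set.disjoint_left]
    intro t h1 h2
    have h1 : f t * n ≤ k := h1
    have h2 : (k : ℝ) + 1 ≤ f t * n := h2
    linarith
  choose e he he1 heb using hstep
  refine ⟨(n : ℂ)⁻¹ • ∑ k ∈ Finset.range n, e k * b, fun t => ?_⟩
  have hnC : (n : ℂ) ≠ 0 := by exact_mod_cast hn0.ne'
  have hsum : (f t : ℂ) • π t b - π t ((n : ℂ)⁻¹ • ∑ k ∈ Finset.range n, e k * b) =
      (n : ℂ)⁻¹ • ∑ k ∈ Finset.range n,
        (((max 0 (min 1 (f t * n - k)) : ℝ) : ℂ) • π t b - π t (e k * b)) := by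
    rw [Finset.sum_sub_distrib, ← Finset.sum_smul, ← Complex.ofReal_sum, sum_range_max_min_sub,
      min_eq_right (mul_le_of_le_one_left hn0.le (hf1 t)),
      max_eq_right (mul_nonneg (hf0 t) hn0.le), smul_sub, smul_smul, map_smul, map_sum]
    congr 2
    push_cast
    field_simp
  -- Only the one band with `k < n f t < k + 1` is uncontrolled. Its error `2 ‖b‖` is harmless after
  -- division by `n`.
  have hterm : ∀ k ∈ Finset.range n,
      ‖((max 0 (min 1 (f t * n - k)) : ℝ) : ℂ) • π t b - π t (e k * b)‖ ≤
        ε / 2 + if k = ⌊f t * n⌋₊ then 2 * ‖b‖ else 0 := by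
    intro k _
    rcases le_or_gt (f t * n) k with h1 | h1
    · rw [map_mul, he k t h1, zero_mul, max_eq_left ((min_le_right _ _).trans (by linarith))]
      simp only [Complex.ofReal_zero, zero_smul, sub_zero, norm_zero]
      positivity
    rcases le_or_gt ((k : ℝ) + 1) (f t * n) with h2 | h2
    · rw [min_eq_left (by linarith), max_eq_right zero_le_one, Complex.ofReal_one, one_smul]
      exact (heb k t h2).trans (le_add_of_nonneg_right (by positivity))
    · have hk : k = ⌊f t * n⌋₊ := by
        symm
        rw [Nat.floor_eq_iff (mul_nonneg (hf0 t) hn0.le)]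
        exact ⟨h1.le, h2⟩
      rw [if_pos hk]
      have hb : ‖π t b‖ ≤ ‖b‖ := NonUnitalStarAlgHom.norm_apply_le _ _
      have heb' : ‖π t (e k * b)‖ ≤ ‖b‖ := (NonUnitalStarAlgHom.norm_apply_le _ _).trans
        ((norm_mul_le _ _).trans (mul_le_of_le_one_left (norm_nonneg _) (he1 k)))
      have hφ : ‖((max 0 (min 1 (f t * n - k)) : ℝ) : ℂ)‖ ≤ 1 := by
        rw [Complex.norm_real, Real.norm_of_nonneg (le_max_left _ _)]
        exact max_le zero_le_one (min_le_left _ _)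
      calc _ ≤ ‖((max 0 (min 1 (f t * n - k)) : ℝ) : ℂ) • π t b‖ + ‖π t (e k * b)‖ :=
            norm_sub_le _ _
        _ ≤ 1 * ‖b‖ + ‖b‖ := by
            rw [norm_smul]
            gcongr
        _ ≤ _ := by linarith
  rw [hsum, norm_smul, norm_inv, Complex.norm_natCast, inv_mul_le_iff₀ hn0]
  calc _ ≤ ∑ k ∈ Finset.range n, (ε / 2 + if k = ⌊f t * n⌋₊ then 2 * ‖b‖ else 0) :=
        norm_sum_le_of_le _ hterm
    _ ≤ n * (ε / 2) + 2 * ‖b‖ := by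
        rw [Finset.sum_add_distrib, Finset.sum_const, Finset.card_range, nsmul_eq_mul,
          Finset.sum_ite_eq']
        gcongr
        split_ifs
        · exact le_rfl
        · positivity
    _ ≤ n * ε := by
        have : 2 * ‖b‖ < n * (ε / 2) := (div_lt_iff₀ (by positivity)).mp hn
        linarith

/-- A Stone-Weierstrass theorem for fields of elementary C*-algebras. -/
theorem exists_forall_norm_sub_le [T2Space T] [LocallyCompactSpace T] {a : ∀ t, H t →L[ℂ] H t}
    (ha : a ∈ E.sectionAlgebra) {ε : ℝ} (hε : 0 < ε) : ∃ c : S, ∀ t, ‖a t - π t c‖ ≤ ε := by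
  have hV := isCompact_setOf_le_norm ha (by positivity : 0 < ε / 3)
  have hloc : ∀ t, ∃ b : S, ‖a t - π t b‖ < ε / 3 := fun t => by
    obtain ⟨b, -, hb⟩ := exists_mem_vanishingIdeal_norm_sub_lt hπ hirr hreg ha.1 isClosed_empty
      (Set.notMem_empty t) (by positivity : 0 < ε / 3)
    exact ⟨b, hb⟩
  choose b hb using hloc
  have hcont : ∀ r, Continuous fun t => ‖a t - π t (b r)‖ := fun r =>
    (E.sectionAlgebra.sub_mem ha (hπ (b r))).1.continuous_norm
  let W : T → Set T := fun r => {t | ‖a t - π t (b r)‖ < ε / 3}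
  have hW : ∀ r, IsOpen (W r) := fun r => isOpen_lt (hcont r) continuous_const
  obtain ⟨s, hs⟩ := hV.elim_finite_subcover W hW fun t _ => Set.mem_iUnion.mpr ⟨t, hb t⟩
  have hs' : {t | ε / 3 ≤ ‖a t‖} ⊆ ⋃ i : s, W i := by
    intro t ht
    obtain ⟨r, hr, htr⟩ := Set.mem_iUnion₂.mp (hs ht)
    exact Set.mem_iUnion.mpr ⟨⟨r, hr⟩, htr⟩
  obtain ⟨f, hfW, -⟩ := PartitionOfUnity.exists_isSubordinate_of_locallyFinite_t2space hV
    (fun i : s => W i) (fun i => hW i) (locallyFinite_of_finite _) hs'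
  -- The `+ 1` covers an empty subcover.
  let δ := ε / 3 / (Fintype.card s + 1)
  have hδ : 0 < δ := by positivity
  have hDH : ∀ i : s, ∃ c : S, ∀ t, ‖(f i t : ℂ) • π t (b i) - π t c‖ ≤ δ := fun i =>
    exists_norm_smul_sub_le hπ hirr hreg (b i) (f i).continuous (f.nonneg i) (f.le_one i) hδ
  choose c hc using hDH
  refine ⟨∑ i, c i, fun t => ?_⟩
  have hsum_le : ∑ i, f i t ≤ 1 := by
    rw [← finsum_eq_sum_of_fintype]
    exact f.sum_le_one t
  have hsum0 : 0 ≤ ∑ i, f i t := Finset.sum_nonneg fun i _ => f.nonneg i t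
  -- Three errors of at most `ε / 3`: the part missed by the partition of unity, where `a` is small;
  -- the local approximations; and the scalar multiplications.
  have key : a t - π t (∑ i, c i) = ((1 - ∑ i, f i t : ℝ) : ℂ) • a t +
      ∑ i, (f i t : ℂ) • (a t - π t (b i)) + ∑ i, ((f i t : ℂ) • π t (b i) - π t (c i)) := by
    simp only [smul_sub, Finset.sum_sub_distrib, map_sum, ← Finset.sum_smul]
    push_cast
    rw [sub_smul, one_smul]
    abel
  have h1 : ‖((1 - ∑ i, f i t : ℝ) : ℂ) • a t‖ ≤ ε / 3 := by
    rw [norm_smul, Complex.norm_real, Real.norm_of_nonneg (by linarith)]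
    by_cases ht : ε / 3 ≤ ‖a t‖
    · have : ∑ i, f i t = 1 := by
        rw [← finsum_eq_sum_of_fintype]
        exact f.sum_eq_one ht
      rw [this, sub_self, zero_mul]
      positivity
    · push Not at ht
      calc _ ≤ 1 * ‖a t‖ := by gcongr; linarith
        _ ≤ _ := by linarith
  have h2 : ‖∑ i, (f i t : ℂ) • (a t - π t (b i))‖ ≤ ε / 3 := by
    calc _ ≤ ∑ i, f i t * (ε / 3) := norm_sum_le_of_le _ fun i _ => by
          rw [norm_smul, Complex.norm_real, Real.norm_of_nonneg (f.nonneg i t)]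
          by_cases hi : f i t = 0
          · rw [hi, zero_mul, zero_mul]
          · have : t ∈ W i := hfW i (subset_tsupport _ hi)
            have : ‖a t - π t (b i)‖ < ε / 3 := this
            exact mul_le_mul_of_nonneg_left this.le (f.nonneg i t)
      _ ≤ 1 * (ε / 3) := by
          rw [← Finset.sum_mul]
          gcongr
      _ = _ := one_mul _
  have h3 : ‖∑ i, ((f i t : ℂ) • π t (b i) - π t (c i))‖ ≤ ε / 3 := by
    calc _ ≤ ∑ i : s, δ := norm_sum_le_of_le _ fun i _ => hc i t
      _ = Fintype.card s * δ := by
          rw [Finset.sum_const, nsmul_eq_mul, Finset.card_univ]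
      _ ≤ (Fintype.card s + 1) * δ := by gcongr; linarith
      _ = _ := by simp only [δ]; field_simp
  rw [key]
  refine (norm_add_le _ _).trans ?_
  linarith [norm_add_le (((1 - ∑ i, f i t : ℝ) : ℂ) • a t) (∑ i, (f i t : ℂ) • (a t - π t (b i)))]

end ContinuousHilbertField

/-! ### Density of the Pedersen ideal and extension to all of `S` -/

section Pedersen

variable {S : Type u} [NonUnitalCStarAlgebra S] [PartialOrder S] [StarOrderedRing S]

/-- The Pedersen ideal is dense in the positive cone. -/
theorem exists_mem_pedersenPositive_norm_sub_le {a : S} (ha : 0 ≤ a) {ε : ℝ} (hε : 0 < ε) :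
    ∃ g ∈ pedersenPositive S, ‖a - g‖ ≤ ε := by
  have hsa : IsSelfAdjoint a := .of_nonneg ha
  -- The branch `R - x` only makes the support of `φ` compact. This `R` is large enough that `φ x =
  -- max 0 (x - ε)` for `x ≤ ‖a‖`, hence on the spectrum of `a`.
  let R := 2 * ‖a‖ + ε
  let φ : ℝ → ℝ := fun x => max 0 (min (x - ε) (R - x))
  have hφ : Continuous φ := by fun_prop
  have hφ0 : φ 0 = 0 := max_eq_left ((min_le_left _ _).trans (by linarith))
  have hnn : ∀ x, 0 ≤ φ x := fun x => le_max_left _ _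
  have hsupp : tsupport φ ⊆ Set.Icc ε R := by
    refine closure_minimal (fun x hx => ?_) isClosed_Icc
    by_contra hnot
    refine hx (max_eq_left ?_)
    rw [Set.mem_Icc, not_and_or, not_le, not_le] at hnot
    rcases hnot with h | h
    · exact (min_le_left _ _).trans (by linarith)
    · exact (min_le_right _ _).trans (by linarith)
  have hgen : cfcₙ φ a ∈ pedersenGenerators S :=
    ⟨cfcₙ_nonneg fun x _ => hnn x, a, ha, φ, hφ, hnn,
      isCompact_Icc.of_isClosed_subset (isClosed_tsupport φ) hsupp,
      fun x hx => hε.trans_le (hsupp hx).1, rfl⟩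
  refine ⟨cfcₙ φ a, ⟨hgen.1, 1, fun _ => cfcₙ φ a, fun _ => hgen, by simp⟩, ?_⟩
  have hid : a = cfcₙ (fun x : ℝ => x) a := (cfcₙ_id' ℝ a hsa).symm
  have e : a - cfcₙ φ a = cfcₙ (fun x => x - φ x) a := by
    rw [cfcₙ_sub (fun x : ℝ => x) φ a (hf := by fun_prop) (hf0 := rfl) (hg := by fun_prop)
      (hg0 := hφ0), ← hid]
  rw [e]
  refine norm_cfcₙ_le fun x hx => ?_
  have hx0 : 0 ≤ x := quasispectrum_nonneg_of_nonneg a ha x hx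
  have hx1 : x ≤ ‖a‖ := by
    have := norm_apply_le_norm_cfcₙ (fun x : ℝ => x) a hx (by fun_prop) rfl hsa
    rw [← hid] at this
    exact (le_abs_self x).trans this
  have : φ x = max 0 (x - ε) := by
    simp only [φ]
    rw [min_eq_left (by simp only [R]; linarith)]
  rw [this, Real.norm_eq_abs, abs_le]
  rcases le_total 0 (x - ε) with h | h
  · rw [max_eq_right h]
    constructor <;> linarith
  · rw [max_eq_left h]
    constructor <;> linarith

end Pedersen

namespace ContinuousHilbertField

variable {T : Type w} [TopologicalSpace T] {H : T → Type v}
  [∀ t, NormedAddCommGroup (H t)] [∀ t, InnerProductSpace ℂ (H t)]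
  [∀ t, CompleteSpace (H t)] {E : ContinuousHilbertField H}

theorem mem_sectionAlgebra_of_uniform_limit {a : ∀ t, H t →L[ℂ] H t}
    (h : ∀ ε : ℝ, 0 < ε → ∃ b ∈ E.sectionAlgebra, ∀ t, ‖a t - b t‖ ≤ ε) :
    a ∈ E.sectionAlgebra := by
  have hla : LocallyApproximable (E.finiteRankSections : Set (∀ t, H t →L[ℂ] H t)) a := by
    intro t ε hε
    obtain ⟨b, hb, hab⟩ := h (ε / 2) (half_pos hε)
    obtain ⟨c, hc, hbc⟩ := hb.1.2 t (ε / 2) (half_pos hε)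
    refine ⟨c, hc, ?_⟩
    filter_upwards [hbc] with s hs
    rw [← sub_add_sub_cancel _ (b s)]
    linarith [norm_add_le (a s - b s) (b s - c s), hab s]
  refine ⟨⟨E.isCompactOperator_of_locallyApproximable hla, hla⟩, ?_⟩
  rw [Metric.tendsto_nhds]
  intro ε hε
  obtain ⟨b, hb, hab⟩ := h (ε / 2) (half_pos hε)
  filter_upwards [hb.2.eventually (Iio_mem_nhds (half_pos hε))] with t ht
  have ht : ‖b t‖ < ε / 2 := ht
  rw [Real.dist_eq, sub_zero, abs_norm]
  have := norm_add_le (a t - b t) (b t)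
  rw [sub_add_cancel] at this
  linarith [hab t]

theorem mem_sectionAlgebra_of_pedersenPositive {S : Type u} [NonUnitalCStarAlgebra S]
    [PartialOrder S] [StarOrderedRing S] {π : ∀ t, S →⋆ₙₐ[ℂ] (H t →L[ℂ] H t)}
    (hK : ∀ a ∈ pedersenPositive S, (fun t => π t a) ∈ E.sectionAlgebra) (a : S) :
    (fun t => π t a) ∈ E.sectionAlgebra := by
  have hpos : ∀ b : S, 0 ≤ b → (fun t => π t b) ∈ E.sectionAlgebra := by
    intro b hb
    refine mem_sectionAlgebra_of_uniform_limit fun ε hε => ?_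
    obtain ⟨g, hg, hbg⟩ := exists_mem_pedersenPositive_norm_sub_le hb hε
    refine ⟨_, hK g hg, fun t => ?_⟩
    rw [← map_sub]
    exact (NonUnitalStarAlgHom.norm_apply_le _ _).trans hbg
  have ha : a ∈ Submodule.span ℂ {b : S | 0 ≤ b} := by
    rw [CStarAlgebra.span_nonneg]; trivial
  induction ha using Submodule.span_induction with
  | zero => simp_rw [map_zero]; exact E.sectionAlgebra.zero_mem
  | add p q _ _ hp hq => simp_rw [map_add]; exact E.sectionAlgebra.add_mem hp hq
  | smul c p _ hp => simp_rw [map_smul]; exact SMulMemClass.smul_mem c hp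
  | mem p hp => exact hpos p hp

end ContinuousHilbertField

/-- Primitive ideals are prime, by density of orbits. This handles intersections of open sets in the
spectrum. -/
theorem IsIrreducibleRep.exists_mul_mul_ne_zero {A : Type u} [NonUnitalCStarAlgebra A] {H : Type v}
    [NormedAddCommGroup H] [InnerProductSpace ℂ H] [CompleteSpace H]
    {ρ : A →⋆ₙₐ[ℂ] (H →L[ℂ] H)} (hρ : IsIrreducibleRep ρ) {a b : A} (ha : ρ a ≠ 0)
    (hb : ρ b ≠ 0) : ∃ s, ρ (a * s * b) ≠ 0 := by
  by_contra! h
  obtain ⟨x, hx⟩ : ∃ x, ρ b x ≠ 0 := by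
    by_contra! h0
    exact hb (by ext x; simp [h0 x])
  apply ha
  have heq : ⇑(ρ a) = fun _ => 0 :=
    Continuous.ext_on (hρ.dense_orbit hx) (ρ a).continuous continuous_const (by
      rintro _ ⟨s, rfl⟩
      simpa [mul_assoc] using congrArg (fun R : H →L[ℂ] H => R x) (h s))
  ext x
  rw [heq]
  rfl

/-! ### Topology of the spectrum and surjectivity -/

namespace CStarSpectrum

variable {S : Type u} [NonUnitalCStarAlgebra S] {H : CStarSpectrum.{u, v} S → Type v}
  [∀ γ, NormedAddCommGroup (H γ)] [∀ γ, InnerProductSpace ℂ (H γ)] [∀ γ, CompleteSpace (H γ)]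
  {π : ∀ γ, S →⋆ₙₐ[ℂ] (H γ →L[ℂ] H γ)} {hirr : ∀ γ, IsIrreducibleRep (π γ)}

theorem mem_ker_iff (hπ : ∀ γ, CStarSpectrum.mk (π γ) (hirr γ) = γ) {γ : CStarSpectrum.{u, v} S}
    {a : S} : a ∈ γ.ker ↔ π γ a = 0 := by
  conv_lhs => rw [← hπ γ]
  exact TwoSidedIdeal.mem_ker _

/-- Points are separated from closed sets by elements of the algebra. -/
theorem exists_mem_vanishingIdeal_compl (hπ : ∀ γ, CStarSpectrum.mk (π γ) (hirr γ) = γ)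
    {U : Set (CStarSpectrum.{u, v} S)} (hU : IsOpen U) {γ : CStarSpectrum.{u, v} S} (hγ : γ ∈ U) :
    ∃ a ∈ vanishingIdeal π Uᶜ, π γ a ≠ 0 := by
  induction hU with
  | basic U hU =>
    obtain ⟨I, -, rfl⟩ := hU
    obtain ⟨a, haI, ha⟩ := SetLike.not_le_iff_exists.mp (show ¬ I ≤ γ.ker from hγ)
    refine ⟨a, fun t ht => ?_, fun h => ha ((mem_ker_iff hπ).mpr h)⟩
    have ht : I ≤ t.ker := not_not.mp ht
    exact (mem_ker_iff hπ).mp (ht haI)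
  | univ =>
    by_contra! h
    refine (hirr γ).1 ?_
    ext a x
    rw [h a fun t ht => absurd trivial ht]
    rfl
  | inter U V _ _ hU hV =>
    obtain ⟨a, ha, haγ⟩ := hU hγ.1
    obtain ⟨b, hb, hbγ⟩ := hV hγ.2
    obtain ⟨s, hs⟩ := (hirr γ).exists_mul_mul_ne_zero haγ hbγ
    refine ⟨a * s * b, fun t ht => ?_, hs⟩
    rw [map_mul, map_mul]
    rw [Set.compl_inter] at ht
    rcases ht with ht | ht
    · rw [ha t ht, zero_mul, zero_mul]
    · rw [hb t ht, mul_zero]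
  | sUnion 𝒰 _ h =>
    obtain ⟨U, hU, hγU⟩ := hγ
    obtain ⟨a, ha, haγ⟩ := h U hU hγU
    exact ⟨a, fun t ht => ha t fun htU => ht ⟨U, hU, htU⟩, haγ⟩

variable {E : ContinuousHilbertField H}

/-- The isometry of fibres sends `x γ` to `x δ` for every section `x`. As `π(a) x` is again a
section, it intertwines `π γ` and `π δ`. -/
theorem eq_of_inseparable (hπ : ∀ γ, CStarSpectrum.mk (π γ) (hirr γ) = γ)
    (hE : ∀ a, (fun γ => π γ a) ∈ E.sectionAlgebra) {γ δ : CStarSpectrum.{u, v} S}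
    (h : Inseparable γ δ) : γ = δ := by
  obtain ⟨U, hU⟩ := E.exists_linearIsometryEquiv_of_inseparable h
  rw [← hπ γ, ← hπ δ]
  refine Quotient.sound ⟨U, fun a => ?_⟩
  have hext : (fun ξ => U (π γ a ξ)) = fun ξ => π δ a (U ξ) := by
    refine Continuous.ext_on (E.dense_fiber γ) (by fun_prop) (by fun_prop) ?_
    rintro _ ⟨x, hx, rfl⟩
    change U (π γ a (x γ)) = π δ a (U (x γ))
    rw [hU x hx]
    exact hU _ ((hE a).1.apply_mem_sections hx)
  exact fun ξ => congrFun hext ξ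

/-- Distinct points are told apart by an open set, hence by some `a` whose norm function vanishes at
exactly one of them; that function is continuous. -/
theorem t2Space_of_mem_sectionAlgebra (hπ : ∀ γ, CStarSpectrum.mk (π γ) (hirr γ) = γ)
    (hE : ∀ a, (fun γ => π γ a) ∈ E.sectionAlgebra) : T2Space (CStarSpectrum.{u, v} S) := by
  refine ⟨fun γ δ hne => ?_⟩
  have hins : ¬ Inseparable γ δ := fun h => hne (eq_of_inseparable hπ hE h)
  rw [inseparable_iff_forall_isOpen] at hins
  push Not at hins
  obtain ⟨U, hU, hmem⟩ := hins
  have key : ∀ t s, t ∈ U → s ∉ U → ∃ a, ‖π t a‖ ≠ ‖π s a‖ := by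
    intro t s ht hs
    obtain ⟨a, ha, hat⟩ := exists_mem_vanishingIdeal_compl hπ hU ht
    refine ⟨a, ?_⟩
    rw [ha s hs, norm_zero]
    exact norm_ne_zero_iff.mpr hat
  rcases hmem with ⟨h1, h2⟩ | ⟨h1, h2⟩
  · obtain ⟨a, ha⟩ := key γ δ h1 h2
    exact separated_by_continuous (hE a).1.continuous_norm ha
  · obtain ⟨a, ha⟩ := key δ γ h2 h1
    exact separated_by_continuous (hE a).1.continuous_norm ha.symm

theorem weaklyLocallyCompactSpace_of_mem_sectionAlgebra
    (hπ : ∀ γ, CStarSpectrum.mk (π γ) (hirr γ) = γ)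
    (hE : ∀ a, (fun γ => π γ a) ∈ E.sectionAlgebra) :
    WeaklyLocallyCompactSpace (CStarSpectrum.{u, v} S) := by
  refine ⟨fun γ => ?_⟩
  obtain ⟨a, -, ha⟩ := exists_mem_vanishingIdeal_compl hπ isOpen_univ (Set.mem_univ γ)
  have hpos : 0 < ‖π γ a‖ := norm_pos_iff.mpr ha
  refine ⟨_, ContinuousHilbertField.isCompact_setOf_le_norm (hE a) (half_pos hpos), ?_⟩
  filter_upwards [((hE a).1.continuous_norm.tendsto γ).eventually
    (Ioi_mem_nhds (half_lt_self hpos))] with s hs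
  exact le_of_lt hs

theorem norm_le_of_forall_norm_le [TopologicalSpace.SeparableSpace S]
    (hπ : ∀ γ, CStarSpectrum.mk (π γ) (hirr γ) = γ) {a : S} {C : ℝ} (hC : 0 ≤ C)
    (h : ∀ γ, ‖π γ a‖ ≤ C) : ‖a‖ ≤ C := by
  by_cases ha : a = 0
  · rwa [ha, norm_zero]
  · obtain ⟨γ, hγ⟩ := exists_norm_eq π hirr hπ ha
    exact hγ ▸ h γ

/-- Since the map is isometric, uniform approximants of `T` form a Cauchy sequence in `S`, and the
limit represents `T`. -/
theorem exists_eq_of_mem_sectionAlgebra [TopologicalSpace.SeparableSpace S]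
    (hπ : ∀ γ, CStarSpectrum.mk (π γ) (hirr γ) = γ)
    (hE : ∀ a, (fun γ => π γ a) ∈ E.sectionAlgebra) {T : ∀ γ, H γ →L[ℂ] H γ}
    (hT : T ∈ E.sectionAlgebra) : ∃ a, ∀ γ, π γ a = T γ := by
  have := t2Space_of_mem_sectionAlgebra hπ hE
  have := weaklyLocallyCompactSpace_of_mem_sectionAlgebra hπ hE
  have happ : ∀ n : ℕ, ∃ c : S, ∀ γ, ‖T γ - π γ c‖ ≤ 1 / ((n : ℝ) + 1) := fun n =>
    ContinuousHilbertField.exists_forall_norm_sub_le hE hirr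
      (fun U hU γ hγ => exists_mem_vanishingIdeal_compl hπ hU hγ) hT (by positivity)
  choose c hc using happ
  have hlim0 : Tendsto (fun n : ℕ => 1 / ((n : ℝ) + 1)) atTop (𝓝 0) :=
    tendsto_one_div_add_atTop_nhds_zero_nat
  have hcauchy : CauchySeq c := by
    refine cauchySeq_of_le_tendsto_0' (fun n : ℕ => 1 / ((n : ℝ) + 1) + 1 / ((n : ℝ) + 1))
      (fun n m hnm => ?_) (by simpa using hlim0.add hlim0)
    rw [dist_eq_norm]
    refine norm_le_of_forall_norm_le hπ (by positivity) fun γ => ?_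
    have e : π γ (c n - c m) = (T γ - π γ (c m)) - (T γ - π γ (c n)) := by
      rw [map_sub]; abel
    rw [e]
    refine (norm_sub_le _ _).trans (add_le_add ((hc m γ).trans ?_) (hc n γ))
    gcongr
  obtain ⟨a, ha⟩ := cauchySeq_tendsto_of_complete hcauchy
  refine ⟨a, fun γ => ?_⟩
  have h1 : Tendsto (fun n => π γ (c n)) atTop (𝓝 (π γ a)) :=
    ((π γ).continuous_of_cstar.tendsto a).comp ha
  have h2 : Tendsto (fun n => π γ (c n)) atTop (𝓝 (T γ)) := by
    rw [tendsto_iff_norm_sub_tendsto_zero]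
    refine squeeze_zero (fun _ => norm_nonneg _) (fun n => ?_) hlim0
    rw [norm_sub_rev]
    exact hc n γ
  exact tendsto_nhds_unique h1 h2

end CStarSpectrum

/-! ### The isomorphism -/

theorem corollary2p5 {S : Type u} [NonUnitalCStarAlgebra S] [PartialOrder S] [StarOrderedRing S]
    [TopologicalSpace.SeparableSpace S] (hS : HasContinuousTrace.{u, v} S)
    {H : CStarSpectrum.{u, v} S → Type v} [∀ γ, NormedAddCommGroup (H γ)]
    [∀ γ, InnerProductSpace ℂ (H γ)] [∀ γ, CompleteSpace (H γ)]
    (E : ContinuousHilbertField H)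
    (π : ∀ γ, S →⋆ₙₐ[ℂ] (H γ →L[ℂ] H γ)) (hirr : ∀ γ, IsIrreducibleRep (π γ))
    (hπ : ∀ γ, CStarSpectrum.mk (π γ) (hirr γ) = γ)
    (hK : ∀ a ∈ pedersenPositive S, (fun γ => π γ a) ∈ E.sectionAlgebra) :
    ∃ Φ : S ≃⋆ₐ[ℂ] E.sectionAlgebra,
      ∀ (a : S) (γ : CStarSpectrum.{u, v} S),
        (Φ a : ∀ γ, H γ →L[ℂ] H γ) γ = π γ a := by
  have hE := ContinuousHilbertField.mem_sectionAlgebra_of_pedersenPositive hK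
  let φ : S →⋆ₙₐ[ℂ] E.sectionAlgebra :=
    { toFun := fun a => ⟨fun γ => π γ a, hE a⟩
      map_smul' := fun c a => Subtype.ext (funext fun γ => map_smul (π γ) c a)
      map_zero' := Subtype.ext (funext fun γ => map_zero (π γ))
      map_add' := fun a b => Subtype.ext (funext fun γ => map_add (π γ) a b)
      map_mul' := fun a b => Subtype.ext (funext fun γ => map_mul (π γ) a b)
      map_star' := fun a => Subtype.ext (funext fun γ => map_star (π γ) a) }
  have hφ : ∀ a γ, (φ a : ∀ γ, H γ →L[ℂ] H γ) γ = π γ a := fun a γ => rfl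
  have hinj : Function.Injective φ := by
    rw [injective_iff_map_eq_zero]
    intro a ha
    refine norm_le_zero_iff.mp (CStarSpectrum.norm_le_of_forall_norm_le hπ le_rfl fun γ => ?_)
    rw [← hφ, ha]
    exact norm_zero.le
  have hsurj : Function.Surjective φ := fun T => by
    obtain ⟨a, ha⟩ := CStarSpectrum.exists_eq_of_mem_sectionAlgebra hπ hE T.2
    exact ⟨a, Subtype.ext (funext ha)⟩
  exact ⟨StarAlgEquiv.ofBijective φ ⟨hinj, hsurj⟩, hφ⟩
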